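/- **Conventions.** Matrices are complex, $\|\cdot\|$ is the operator norm induced by the Euclidean norm, $\otimes$ is the Kronecker product, real powers and logarithms of positive definite matrices are given by functional calculus, $X\ge 0$ means positive semidefinite, and $\delta_k:=2^{-k}$. For positive definite $K$ put $\mathcal S_K(T):=\int_0^\infty e^{-sK}Te^{-sK}\,ds$ (the unique solution $Q$ of $KQ+QK=T$). *The matrices $F_{q,L}$.* For $L$ positive definite, $F$ Hermitian, $q\in[0,1]$, let $F_{1,L}:=F$ and let $F_{2^{-j-1},L}:=\mathcal S_{L^{2^{-j-1}}}(F_{2^{-j},L})$, $j\ge 0$; let $\widetilde F_L:=\lim_{j\to\infty}2^jF_{2^{-j},L}$ and $F_{q,L}:=\int_0^qL^s\widetilde F_LL^{q-s}\,ds$ (consistent with the previous values; it is the first order coefficient of $(L+\epsilon F)^q$). *The matrix $\mathrm{Cross}$.* For $A,B$ positive definite and $X,Z$ Hermitian, let $M:=\frac{A+B}2$, $\psi:=M^{-1/2}\frac{A-B}2M^{-1/2}$, $E_2:=M^{-1/2}\frac{X-Z}2M^{-1/2}$, $E_1:=-M^{-1/2}\frac{X+Z}2M^{-1/2}$, $R:=E_2+\psi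 E_1$, and for $s>0$ let $\widetilde\psi(s):=\sum_{k\ge0}(1+s)^{-k}\psi^{2k}$ and $\Omega(s):=(1+s)^{-1/2}R+(1+s)^{-3/2}\psi R\psi$. Define $$\mathrm{Cross}_{A,B}(X,Z):=\tfrac1\pi M^{1/2}\Big[\int_0^\infty \tfrac{s^{1/2}}{1+s}\,\widetilde\psi(s)\Omega(s)\widetilde\psi(s)\Omega(s)^*\widetilde\psi(s)\,ds+\psi\Big(\int_0^\infty\tfrac{s^{1/2}}{(1+s)^3}\,\widetilde\psi(s)RR^*\widetilde\psi(s)\,ds\Big)\psi\Big]M^{1/2}.$$ *The matrices $\Gamma_k$.* For $N\times N$ matrices $\Psi,\Phi$ positive definite and $V,W$ Hermitian, let $D_\delta:=\mathcal S_{\Psi^\delta\otimes\Phi^{-\delta}}$, for $l\ge1$ let $$\mathrm{Source}_l:=\mathrm{Cross}_{\Psi^{1-\delta_{l-1}}\otimes\Phi^{\delta_{l-1}},\ \Psi\otimes I}\big(V_{1-\delta_{l-1},\Psi}\otimes\Phi^{\delta_{l-1}}+\Psi^{1-\delta_{l-1}}\otimes W_{\delta_{l-1},\Phi},\ V\otimes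 I\big),$$ and for $k\ge 1$ let $$\Gamma_k:=\mathrm{Source}_k+D_{-2^{-k}}(\mathrm{Source}_{k-1})+D_{-2^{-k}}(D_{-2^{-k+1}}(\mathrm{Source}_{k-2}))+\dots+D_{-2^{-k}}(D_{-2^{-k+1}}(\cdots D_{-1/4}(\mathrm{Source}_1))).$$ Let $F_k(A,B):=A^{1-\delta_k}\otimes B^{\delta_k}$, $F(A,B):=A\log_2A\otimes I-A\otimes\log_2B$, and $S(A|B):=\mathrm{Tr}[A\log_2A]-\mathrm{Tr}[A\log_2B]$. **Theorem.** Let $A_1,A_2,B_1,B_2$ be positive definite $N\times N$ matrices. For $t_0\in[0,1]$ put $\Psi=t_0A_1+(1-t_0)A_2$, $\Phi=t_0B_1+(1-t_0)B_2$, $V=A_1-A_2$, $W=B_1-B_2$, let $\Gamma_k(t_0)$ be the matrix $\Gamma_k$ for these $\Psi,\Phi,V,W$, and let $G_k(\epsilon):=F_k(\Psi+\epsilon V,\Phi+\epsilon W)$ for small real $\epsilon$. Then: 1. For every $k\ge1$, $G_k$ is twice continuously differentiable near $0$ and $G_k''(0)=-2\Gamma_k(t_0)\le0$. 2. There are a positive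 semidefinite matrix $\Gamma(t_0)=\Gamma_{A_1,A_2,B_1,B_2}(t_0)$ and a constant $C$ depending only on $\Psi,\Phi,V,W$ such that $\|2^k\Gamma_k(t_0)-\Gamma(t_0)\|\le C2^{-k}$ for all $k\ge1$. 3. For every $t\in[0,1]$, $\frac{d^2}{dt^2}F\big(tA_1+(1-t)A_2,\ tB_1+(1-t)B_2\big)$ exists and equals $2(\log_2e)\,\Gamma(t)$. 4. Let $V_I:=\sum_ie_i\otimes e_i$, so that $\langle V_I,(A\otimes B^{T})V_I\rangle=\mathrm{Tr}(AB)$, and let $\widehat\Gamma(\sigma):=\Gamma_{A_1,A_2,B_1^{T},B_2^{T}}(\sigma)$ be the matrix from part 2 for $A_1,A_2$ and the transposes $B_1^{T},B_2^{T}$. Then for every $t\in[0,1]$ $$S\big(tA_1+(1-t)A_2\,\big|\,tB_1+(1-t)B_2\big)=tS(A_1|B_1)+(1-t)S(A_2|B_2)-2(\log_2e)\,t\int_0^1\int_{t\lambda}^{\lambda}\langle V_I,\widehat\Gamma(\sigma)V_I\rangle\,d\sigma\,d\lambda .$$ -/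

import Mathlib

open Set MeasureTheory Filter Topology
open scoped Matrix ComplexOrder Kronecker Matrix.Norms.L2Operator

/- Throughout, `‖·‖` on complex matrices is the operator norm induced by the Euclidean norm. -/

noncomputable section

namespace JointConvexity

/-- The real power `A ^ r` of a (positive definite) Hermitian matrix, by functional calculus. -/
def mpow {m : Type*} [Fintype m] [DecidableEq m] (A : Matrix m m ℂ) (r : ℝ) : Matrix m m ℂ :=
  cfc (fun x : ℝ => x ^ r) A

/-- The base-two logarithm of a (positive definite) Hermitian matrix, by functional calculus. -/
def mlog2 {m : Type*} [Fintype m] [DecidableEq m] (A : Matrix m m ℂ) : Matrix m m ℂ :=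
  cfc (Real.logb 2) A

/-- `∫₀^∞ e^{-sK} F e^{-sK} ds`; for positive definite `K` it is the unique solution `Q` of the
Sylvester equation `K Q + Q K = F`. -/
def sylv {m : Type*} [Fintype m] [DecidableEq m] (K F : Matrix m m ℂ) : Matrix m m ℂ :=
  ∫ s in Ioi (0 : ℝ), NormedSpace.exp ((-s) • K) * F * NormedSpace.exp ((-s) • K)

/-! ### The second order term of the geometric mean -/

section Cross

variable {m : Type*} [Fintype m] [DecidableEq m]

/-- `((A + B) / 2) ^ (-1/2) * Y * ((A + B) / 2) ^ (-1/2)`. -/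
def midConj (A B Y : Matrix m m ℂ) : Matrix m m ℂ :=
  mpow ((1 / 2 : ℝ) • (A + B)) (-1 / 2) * Y * mpow ((1 / 2 : ℝ) • (A + B)) (-1 / 2)

/-- The matrix `Ψ` attached to the pair `A, B`. -/
def psi (A B : Matrix m m ℂ) : Matrix m m ℂ := midConj A B ((1 / 2 : ℝ) • (A - B))

def E₂ (A B X Z : Matrix m m ℂ) : Matrix m m ℂ := midConj A B ((1 / 2 : ℝ) • (X - Z))

def E₁ (A B X Z : Matrix m m ℂ) : Matrix m m ℂ := -midConj A B ((1 / 2 : ℝ) • (X + Z))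

/-- `∑ₖ (1 + s)^{-k} Ψ^{2k}`. -/
def psiTilde (A B : Matrix m m ℂ) (s : ℝ) : Matrix m m ℂ :=
  ∑' k : ℕ, ((1 + s)⁻¹ ^ k) • psi A B ^ (2 * k)

/-- `E₂ + Ψ E₁`, the adjoint of `E₂ + E₁ Ψ`. -/
def E₂₁ (A B X Z : Matrix m m ℂ) : Matrix m m ℂ := E₂ A B X Z + psi A B * E₁ A B X Z

def Omega (A B X Z : Matrix m m ℂ) (s : ℝ) : Matrix m m ℂ :=
  ((1 + s) ^ (-1 / 2 : ℝ)) • E₂₁ A B X Z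
    + ((1 + s) ^ (-1 - 1 / 2 : ℝ)) • (psi A B * E₂₁ A B X Z * psi A B)

/-- `Cross_{A,B}(X, Z)`: minus one half of the second derivative at `ε = 0` of the geometric mean
of `A + ε X` and `B + ε Z`, written as a manifestly positive semidefinite matrix. -/
def Cross (A B X Z : Matrix m m ℂ) : Matrix m m ℂ :=
  (1 / Real.pi) •
    (mpow ((1 / 2 : ℝ) • (A + B)) (1 / 2) *
      ((∫ s in Ioi (0 : ℝ), (s ^ (1 / 2 : ℝ) * (1 + s)⁻¹) •
          (psiTilde A B s * Omega A B X Z s * psiTilde A B s * (Omega A B X Z s)ᴴ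
            * psiTilde A B s))
        + psi A B *
          (∫ s in Ioi (0 : ℝ), (s ^ (1 / 2 : ℝ) * ((1 + s) ^ 3)⁻¹) •
            (psiTilde A B s * E₂₁ A B X Z * (E₂₁ A B X Z)ᴴ * psiTilde A B s))
          * psi A B) *
      mpow ((1 / 2 : ℝ) • (A + B)) (1 / 2))

end Cross

/-! ### The first order term of matrix powers -/

section Powers

variable {n : Type*} [Fintype n] [DecidableEq n]

/-- `F_{1/2^j, L}`, the first order coefficient of `(L + ε F)^{1/2^j}`: it starts from
`F_{1, L} = F`, and `F_{1/2^{j+1}, L}` solves the Sylvester equation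
`L^{1/2^{j+1}} Q + Q L^{1/2^{j+1}} = F_{1/2^j, L}`. -/
def dyadicCoeff (L F : Matrix n n ℂ) : ℕ → Matrix n n ℂ
  | 0 => F
  | j + 1 => sylv (mpow L (1 / 2 ^ (j + 1))) (dyadicCoeff L F j)

/-- `lim_j 2^j F_{1/2^j, L}`. -/
def coeffLimit (L F : Matrix n n ℂ) : Matrix n n ℂ :=
  limUnder atTop (fun j : ℕ => (2 ^ j : ℝ) • dyadicCoeff L F j)

/-- `F_{q, L}`, the first order coefficient of `(L + ε F)^q`. -/
def firstCoeff (q : ℝ) (L F : Matrix n n ℂ) : Matrix n n ℂ :=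
  ∫ s in (0 : ℝ)..q, mpow L s * coeffLimit L F * mpow L (q - s)

end Powers

/-! ### Sources, the operators `D_δ`, and `Γ_k` -/

section Gamma

variable {n : Type*} [Fintype n] [DecidableEq n]

/-- `δ_k = 2^{-k}`. -/
def dlt (k : ℕ) : ℝ := (2 ^ k)⁻¹

/-- `K_δ = Ψ^δ ⊗ Φ^{-δ}`. -/
def Kdelta (Ψ Φ : Matrix n n ℂ) (δ : ℝ) : Matrix (n × n) (n × n) ℂ :=
  mpow Ψ δ ⊗ₖ mpow Φ (-δ)

/-- `D_δ(T) = ∫₀^∞ e^{-s K_δ} T e^{-s K_δ} ds`. -/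
def Dop (Ψ Φ : Matrix n n ℂ) (δ : ℝ) (T : Matrix (n × n) (n × n) ℂ) :
    Matrix (n × n) (n × n) ℂ :=
  sylv (Kdelta Ψ Φ δ) T

/-- `Source_l = Source_{1 - δ_l, δ_l}`, for `l ≥ 1`. -/
def Source (Ψ Φ V W : Matrix n n ℂ) (l : ℕ) : Matrix (n × n) (n × n) ℂ :=
  Cross (mpow Ψ (1 - dlt (l - 1)) ⊗ₖ mpow Φ (dlt (l - 1))) (Ψ ⊗ₖ (1 : Matrix n n ℂ))
    (firstCoeff (1 - dlt (l - 1)) Ψ V ⊗ₖ mpow Φ (dlt (l - 1))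
      + mpow Ψ (1 - dlt (l - 1)) ⊗ₖ firstCoeff (dlt (l - 1)) Φ W)
    (V ⊗ₖ (1 : Matrix n n ℂ))

/-- `D_{-2^{-(l+j)}}(D_{-2^{-(l+j-1)}}(⋯ D_{-2^{-(l+1)}}(T)))`. -/
def iterD (Ψ Φ : Matrix n n ℂ) (l : ℕ) :
    ℕ → Matrix (n × n) (n × n) ℂ → Matrix (n × n) (n × n) ℂ
  | 0, T => T
  | j + 1, T => Dop Ψ Φ (-dlt (l + (j + 1))) (iterD Ψ Φ l j T)

/-- `Γ_k = Source_k + D_{-2^{-k}}(Source_{k-1}) + ⋯ + D_{-2^{-k}}(⋯ D_{-1/4}(Source_1))`. -/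
def GammaK (Ψ Φ V W : Matrix n n ℂ) (k : ℕ) : Matrix (n × n) (n × n) ℂ :=
  ∑ l ∈ Finset.Icc 1 k, iterD Ψ Φ l (k - l) (Source Ψ Φ V W l)

/-- `F_k(A, B) = A^{1 - 2^{-k}} ⊗ B^{2^{-k}}`. -/
def Fk (k : ℕ) (A B : Matrix n n ℂ) : Matrix (n × n) (n × n) ℂ :=
  mpow A (1 - dlt k) ⊗ₖ mpow B (dlt k)

/-- `F(A, B) = A log₂ A ⊗ I - A ⊗ log₂ B`. -/
def Flog (A B : Matrix n n ℂ) : Matrix (n × n) (n × n) ℂ :=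
  (A * mlog2 A) ⊗ₖ (1 : Matrix n n ℂ) - A ⊗ₖ mlog2 B

/-- The relative entropy `S(A | B) = Tr[A log₂ A] - Tr[A log₂ B]`. -/
def relEntropy (A B : Matrix n n ℂ) : ℂ :=
  (A * mlog2 A).trace - (A * mlog2 B).trace

/-- The point `t A₁ + (1 - t) A₂` of the linear path from `A₂` to `A₁`. -/
def path (A₁ A₂ : Matrix n n ℂ) (t : ℝ) : Matrix n n ℂ := t • A₁ + (1 - t) • A₂

/-- The vector `V_I = ∑ᵢ eᵢ ⊗ eᵢ`, which satisfies `⟨V_I, (A ⊗ Bᵀ) V_I⟩ = Tr (A B)`. -/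
def vecI (n : Type*) [DecidableEq n] : n × n → ℂ := fun p => if p.1 = p.2 then 1 else 0

end Gamma

end JointConvexity

end

/-!
The theorem is a statement about the function `u (δ, ε) = (Ψ + ε V) ^ (1 - δ) ⊗ (Φ + ε W) ^ δ`, which
is analytic in both real variables near `ε = 0`, because the logarithm of positive definite matrices
is analytic (`exists_analytic_mlog`: the derivative of `exp` at a Hermitian matrix is injective, so
the inverse function theorem applies).

Write `H δ` for the second derivative of `u` in `ε` at `ε = 0`, so that `G_k''(0) = H (2 ^ (-k))`.
As `u (0, ε)` is affine, `H 0 = 0`, and by the equality of mixed partial derivatives `H' 0` is the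
second derivative of `∂u/∂δ (0, ε) = - log 2 • F`. Hence `Γ`, defined as `F'' / (2 log₂ e)`, equals
`- H' 0 / 2`, and Taylor's formula for `H` on `[0, 1]` is the convergence of `2 ^ k Γ_k` with its
rate, once `G_k''(0) = -2 Γ_k` is known.

For the latter, `G = F_{k+1}`, `P = F_k` and `J = A ^ δ ⊗ B ^ (-δ)` with `δ = 2 ^ (-k-1)` satisfy
`G = J P` and `J G = A ⊗ I`. Two differentiations (`second_order_sylvester`) give, with
`K = J 0 = Ψ ^ δ ⊗ Φ ^ (-δ)` and `T = J' 0`, the Sylvester equation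
`K G'' + G'' K = K P'' K - 2 T (T P)ᴴ`. The matrix `Cross` solves `K Q + Q K = T (T P)ᴴ`
(`Cross_sylvester`): in a common eigenbasis its two integrals combine into an integral of a rational
function against `√s`, which is elementary (`integral_crossKernel`). Solutions of Sylvester equations
with positive definite `K` are unique, so induction on `k` gives `G_k'' = -2 Γ_k`
(`iteratedDeriv_two_kronLine`). Positivity is inherited because `T (T P)ᴴ = T P Tᴴ ≥ 0` and `sylv`
preserves positive semidefiniteness.

The first order coefficients of powers are derivatives of powers: the dyadic ones solve the same
Sylvester equations (`dyadicCoeff_eq`), and the general ones follow by Duhamel's formula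
(`firstCoeff_eq`).

Finally `S (A | B) = ⟨V_I, F (A, Bᵀ) V_I⟩`, so the formula for the relative entropy is an instance of
the interpolation formula for a function with continuous second derivative
(`interpolation_of_second_deriv`).
-/

namespace JointConvexity

open scoped MatrixOrder ContDiff

set_option linter.unusedSectionVars false

variable {m : Type*} [Fintype m] [DecidableEq m]

/-! ### Logarithms and powers of positive definite matrices -/

/-- The natural logarithm of a (positive definite) Hermitian matrix, by functional calculus. -/
noncomputable def mlog (A : Matrix m m ℂ) : Matrix m m ℂ := cfc Real.log A

theorem mlog2_eq (A : Matrix m m ℂ) : mlog2 A = (Real.log 2)⁻¹ • mlog A := by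
  unfold mlog2 mlog
  have : Real.logb 2 = fun x => (Real.log 2)⁻¹ • Real.log x := by
    ext x; simp [Real.logb, div_eq_inv_mul]
  rw [this, cfc_smul _ _ _ (A.finite_real_spectrum.continuousOn _)]

theorem exp_mlog {A : Matrix m m ℂ} (hA : A.PosDef) : NormedSpace.exp (mlog A) = A :=
  CFC.exp_log A hA.isStrictlyPositive

theorem mlog_exp {H : Matrix m m ℂ} (hH : H.IsHermitian) : mlog (NormedSpace.exp H) = H :=
  CFC.log_exp H hH

theorem isHermitian_mlog (A : Matrix m m ℂ) : (mlog A).IsHermitian := cfc_predicate Real.log A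

theorem isHermitian_real_smul {A : Matrix m m ℂ} (hA : A.IsHermitian) (r : ℝ) :
    (r • A).IsHermitian := hA.smul (IsSelfAdjoint.all r)

theorem mpow_eq_exp {A : Matrix m m ℂ} (hA : A.PosDef) (r : ℝ) :
    mpow A r = NormedSpace.exp (r • mlog A) := by
  have hf := A.finite_real_spectrum
  have h1 : (r • mlog A) = cfc (fun x => r • Real.log x) A := by
    rw [cfc_smul _ _ _ (hf.continuousOn _)]; rfl
  have : IsSelfAdjoint (r • mlog A) := isHermitian_real_smul (isHermitian_mlog A) r
  refine Eq.trans ?_ (CFC.real_exp_eq_normedSpace_exp this)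
  rw [h1]
  refine Eq.trans ?_ (cfc_comp' Real.exp (fun x => r • Real.log x) A (by fun_prop)
    (hf.continuousOn _) hA.1)
  refine cfc_congr fun x hx => ?_
  have hx : 0 < x := by
    have := hA.isStrictlyPositive
    grind
  simp [Real.rpow_def_of_pos hx, mul_comm]

theorem posDef_exp {H : Matrix m m ℂ} (hH : H.IsHermitian) : (NormedSpace.exp H).PosDef :=
  (Matrix.nonneg_iff_posSemidef.1 (IsSelfAdjoint.exp_nonneg hH)).posDef_iff_isUnit.2
    (Matrix.isUnit_exp _)

theorem posDef_mpow {A : Matrix m m ℂ} (hA : A.PosDef) (r : ℝ) : (mpow A r).PosDef := by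
  rw [mpow_eq_exp hA]
  exact posDef_exp (isHermitian_real_smul (isHermitian_mlog A) r)

theorem mpow_add {A : Matrix m m ℂ} (hA : A.PosDef) (r s : ℝ) :
    mpow A (r + s) = mpow A r * mpow A s := by
  simp only [mpow_eq_exp hA, add_smul]
  exact Matrix.exp_add_of_commute _ _ (((Commute.refl _).smul_left r).smul_right s)

theorem mpow_zero {A : Matrix m m ℂ} (hA : A.PosDef) : mpow A 0 = 1 := by
  simp [mpow_eq_exp hA]

theorem mpow_one {A : Matrix m m ℂ} (hA : A.PosDef) : mpow A 1 = A := by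
  simp [mpow_eq_exp hA, exp_mlog hA]

/-! ### Uniqueness for the Sylvester equation -/

/-- If `K Q + Q K = 0` then `Q` commutes with `K²`, hence with its positive square root `K`, so
that `2 K Q = 0`. -/
theorem eq_zero_of_sylvester {K Q : Matrix m m ℂ} (hK : K.PosDef) (h : K * Q + Q * K = 0) :
    Q = 0 := by
  have h1 : K * Q = -(Q * K) := eq_neg_of_add_eq_zero_left h
  have hc : Commute (K ^ 2) Q := by
    change K ^ 2 * Q = Q * K ^ 2
    rw [pow_two, mul_assoc, h1, mul_neg, ← mul_assoc, h1, neg_mul, neg_neg, mul_assoc]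
  have hK2 : cfc (fun x : ℝ => √x) (K ^ 2) = K := by
    have h2 : K ^ 2 = cfc (fun x : ℝ => x ^ 2) K := (cfc_pow_id (R := ℝ) K 2 hK.1).symm
    rw [h2]
    refine (cfc_comp' (fun x : ℝ => √x) (fun x : ℝ => x ^ 2) K (by fun_prop) (by fun_prop)
      hK.1).symm.trans ?_
    conv_rhs => rw [← cfc_id ℝ K hK.1]
    refine cfc_congr fun x hx => ?_
    have hx : 0 < x := by
      have := hK.isStrictlyPositive
      grind
    simp [Real.sqrt_sq hx.le]
  have hc2 : Commute K Q := by
    have := hc.cfc_real (fun x : ℝ => √x)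
    rwa [hK2] at this
  have h3 : (2 : ℂ) • (K * Q) = 0 := by
    rw [two_smul]; nth_rw 2 [hc2.eq]; exact h
  have h4 : K * Q = 0 := by simpa using h3
  exact hK.isUnit.mul_left_cancel (by rw [h4, mul_zero])

/-! ### Smoothness of the logarithm -/

theorem contDiff_matrixExp {n : WithTop ℕ∞} :
    ContDiff ℝ n (NormedSpace.exp : Matrix m m ℂ → Matrix m m ℂ) :=
  contDiff_iff_contDiffAt.2 fun x => (NormedSpace.exp_analytic x).contDiffAt

theorem matrixExp_half_mul_half (Y : Matrix m m ℂ) :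
    NormedSpace.exp ((2⁻¹ : ℝ) • Y) * NormedSpace.exp ((2⁻¹ : ℝ) • Y) = NormedSpace.exp Y := by
  rw [← Matrix.exp_add_of_commute _ _ (Commute.refl _), ← add_smul]
  norm_num

/-- Differentiating `exp Y = (exp (Y / 2))²` gives a Sylvester equation, so a vector annihilated by
the derivative of `exp` at `Y` is annihilated by the derivative at `Y / 2`. -/
theorem fderiv_exp_half_eq_zero {Y X : Matrix m m ℂ} (hY : Y.IsHermitian)
    (h : fderiv ℝ (NormedSpace.exp : Matrix m m ℂ → Matrix m m ℂ) Y X = 0) :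
    fderiv ℝ (NormedSpace.exp : Matrix m m ℂ → Matrix m m ℂ) ((2⁻¹ : ℝ) • Y) X = 0 := by
  set e : Matrix m m ℂ → Matrix m m ℂ := NormedSpace.exp with he
  have hd : Differentiable ℝ e := (contDiff_matrixExp (n := 1)).differentiable (by norm_num)
  have h1 : HasFDerivAt (fun Z : Matrix m m ℂ => e ((2⁻¹ : ℝ) • Z))
      ((fderiv ℝ e ((2⁻¹ : ℝ) • Y)).comp
        ((2⁻¹ : ℝ) • ContinuousLinearMap.id ℝ (Matrix m m ℂ))) Y :=
    (hd _).hasFDerivAt.comp Y ((hasFDerivAt_id Y).const_smul (2⁻¹ : ℝ))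
  have h2 := h1.mul' h1
  have h3 : (fun Z : Matrix m m ℂ => e ((2⁻¹ : ℝ) • Z) * e ((2⁻¹ : ℝ) • Z)) = e :=
    funext matrixExp_half_mul_half
  have h4 := h2.unique (by
    have := (hd Y).hasFDerivAt
    rwa [← h3] at this)
  have h5 := DFunLike.congr_fun h4 X
  rw [h3, h] at h5
  have h6 := eq_zero_of_sylvester (posDef_exp (isHermitian_real_smul hY (2⁻¹ : ℝ)))
    (Q := fderiv ℝ e ((2⁻¹ : ℝ) • Y) ((2⁻¹ : ℝ) • X)) (by simpa using h5)
  simpa using h6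

/-- Iterating `fderiv_exp_half_eq_zero`, a vector in the kernel at `Y` is in the kernel at `Y / 2 ^ j`
for all `j`, hence at `0`, where the derivative is the identity. -/
theorem ker_fderiv_exp {Y : Matrix m m ℂ} (hY : Y.IsHermitian) {X : Matrix m m ℂ}
    (h : fderiv ℝ (NormedSpace.exp : Matrix m m ℂ → Matrix m m ℂ) Y X = 0) : X = 0 := by
  set e : Matrix m m ℂ → Matrix m m ℂ := NormedSpace.exp with he
  have hj : ∀ j : ℕ, fderiv ℝ e (((2⁻¹ : ℝ) ^ j) • Y) X = 0 := by
    intro j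
    induction j with
    | zero => simpa using h
    | succ j ih =>
      have := fderiv_exp_half_eq_zero (isHermitian_real_smul hY ((2⁻¹ : ℝ) ^ j)) ih
      rwa [smul_smul, ← pow_succ'] at this
  have hc : Continuous fun Z => fderiv ℝ e Z X :=
    ((contDiff_matrixExp (n := 1)).continuous_fderiv (by norm_num)).clm_apply continuous_const
  have ht : Tendsto (fun j : ℕ => ((2⁻¹ : ℝ) ^ j) • Y) atTop (𝓝 0) := by
    simpa using (tendsto_pow_atTop_nhds_zero_of_lt_one (r := (2⁻¹ : ℝ)) (by norm_num)
      (by norm_num)).smul_const Y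
  have h0 : fderiv ℝ e 0 X = 0 :=
    tendsto_nhds_unique ((hc.tendsto 0).comp ht) (by
      simp only [Function.comp_def, hj, tendsto_const_nhds])
  have h1 : fderiv ℝ e 0 = 1 := (hasFDerivAt_exp_zero (𝕂 := ℝ) (𝔸 := Matrix m m ℂ)).fderiv
  simpa [h1] using h0

/-- Near a positive definite `L`, Hermitian matrices are positive definite and the logarithm is the
restriction of an analytic map: a local inverse of the exponential. -/
theorem exists_analytic_mlog {L : Matrix m m ℂ} (hL : L.PosDef) :
    ∃ g : Matrix m m ℂ → Matrix m m ℂ, ContDiffAt ℝ ω g L ∧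
      ∀ᶠ A in 𝓝 L, A.IsHermitian → A.PosDef ∧ mlog A = g A := by
  set e : Matrix m m ℂ → Matrix m m ℂ := NormedSpace.exp with he
  set H := mlog L
  have hH : H.IsHermitian := isHermitian_mlog L
  have heH : e H = L := exp_mlog hL
  have hcd : ContDiffAt ℝ ω e H := contDiff_matrixExp.contDiffAt
  let f' : Matrix m m ℂ ≃L[ℝ] Matrix m m ℂ :=
    (LinearEquiv.ofInjectiveEndo (fderiv ℝ e H).toLinearMap
      (LinearMap.ker_eq_bot.1 (LinearMap.ker_eq_bot'.2 fun X hX =>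
        ker_fderiv_exp hH hX))).toContinuousLinearEquiv
  have hf' : HasFDerivAt e (f' : Matrix m m ℂ →L[ℝ] Matrix m m ℂ) H :=
    (hcd.differentiableAt (by simp)).hasFDerivAt
  have hn : (ω : WithTop ℕ∞) ≠ 0 := by simp
  have hs := hcd.hasStrictFDerivAt' hf' hn
  set g := hcd.localInverse hf' hn
  have hg : ContDiffAt ℝ ω g L := heH ▸ hcd.to_localInverse hf' hn
  have hgL : g L = H := by rw [← heH]; exact hcd.localInverse_apply_image hf' hn
  refine ⟨g, hg, ?_⟩
  have hr : ∀ᶠ A in 𝓝 L, e (g A) = A := heH ▸ hs.eventually_right_inverse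
  have hl : ∀ᶠ X in 𝓝 H, g (e X) = X := hs.eventually_left_inverse
  -- For Hermitian `A` near `L`, `(g A)ᴴ` is a logarithm of `A` near `H` as well, so it is `g A`.
  have htend : Tendsto (fun A => (g A)ᴴ) (𝓝 L) (𝓝 H) := by
    have h1 : Tendsto g (𝓝 L) (𝓝 H) := hgL ▸ hg.continuousAt
    have h2 := (continuous_star (R := Matrix m m ℂ)).tendsto H
    have h3 : star H = H := hH
    rw [h3] at h2
    exact h2.comp h1
  filter_upwards [hr, htend.eventually hl] with A hA1 hA2 hA
  have h1 : e (g A)ᴴ = A := by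
    have : e (g A)ᴴ = (e (g A))ᴴ := Matrix.exp_conjTranspose _
    rw [this, hA1]; exact hA
  have h2 : (g A).IsHermitian := by
    change (g A)ᴴ = g A
    rw [← hA2, h1]
  refine ⟨?_, ?_⟩
  · rw [← hA1]; exact posDef_exp h2
  · nth_rw 1 [← hA1]; exact mlog_exp h2

/-! ### Unitary conjugation and entrywise integration -/

/-- The diagonal matrix with real entries `k`. -/
noncomputable def rdiag (k : m → ℝ) : Matrix m m ℂ := Matrix.diagonal fun i => (k i : ℂ)

theorem rdiag_mul_apply (k : m → ℝ) (T : Matrix m m ℂ) (i j : m) :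
    (rdiag k * T) i j = k i * T i j := by simp [rdiag, Matrix.diagonal_mul]

theorem mul_rdiag_apply (k : m → ℝ) (T : Matrix m m ℂ) (i j : m) :
    (T * rdiag k) i j = T i j * k j := by simp [rdiag, Matrix.mul_diagonal]

theorem isHermitian_rdiag (k : m → ℝ) : (rdiag k).IsHermitian := by
  rw [rdiag, Matrix.isHermitian_diagonal_iff]
  intro i
  simp [isSelfAdjoint_iff]

theorem rdiag_mul_rdiag (k l : m → ℝ) : rdiag k * rdiag l = rdiag fun i => k i * l i := by
  simp [rdiag]

/-- A star-algebra automorphism of a matrix algebra as a continuous real-linear equivalence. -/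
noncomputable def autCLE (φ : Matrix m m ℂ ≃⋆ₐ[ℂ] Matrix m m ℂ) :
    Matrix m m ℂ ≃L[ℝ] Matrix m m ℂ :=
  (LinearEquiv.restrictScalars ℝ φ.toAlgEquiv.toLinearEquiv).toContinuousLinearEquiv

theorem autCLE_apply (φ : Matrix m m ℂ ≃⋆ₐ[ℂ] Matrix m m ℂ) (X : Matrix m m ℂ) :
    autCLE φ X = φ X := rfl

theorem aut_continuous (φ : Matrix m m ℂ ≃⋆ₐ[ℂ] Matrix m m ℂ) : Continuous φ :=
  (autCLE φ).continuous

theorem aut_real_smul (φ : Matrix m m ℂ ≃⋆ₐ[ℂ] Matrix m m ℂ) (r : ℝ) (X : Matrix m m ℂ) :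
    φ (r • X) = r • φ X := (autCLE φ).map_smul r X

theorem aut_integral (φ : Matrix m m ℂ ≃⋆ₐ[ℂ] Matrix m m ℂ) (f : ℝ → Matrix m m ℂ) (s : Set ℝ) :
    φ (∫ x in s, f x) = ∫ x in s, φ (f x) :=
  ((autCLE φ).integral_comp_comm f).symm

theorem aut_exp (φ : Matrix m m ℂ ≃⋆ₐ[ℂ] Matrix m m ℂ) (X : Matrix m m ℂ) :
    φ (NormedSpace.exp X) = NormedSpace.exp (φ X) := by
  let +nondep : NormedAlgebra ℚ (Matrix m m ℂ) := .restrictScalars ℚ ℂ _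
  exact NormedSpace.map_exp φ (aut_continuous φ) X

theorem aut_cfc (φ : Matrix m m ℂ ≃⋆ₐ[ℂ] Matrix m m ℂ) (f : ℝ → ℝ) {A : Matrix m m ℂ}
    (hA : A.IsHermitian) : φ (cfc f A) = cfc f (φ A) := by
  have h : IsSelfAdjoint (φ A) := by
    rw [isSelfAdjoint_iff, ← map_star]; exact congrArg φ hA
  exact StarAlgHomClass.map_cfc (R := ℝ) (S := ℂ) φ f A (A.finite_real_spectrum.continuousOn _)
    (aut_continuous φ) hA h

theorem aut_sylv (φ : Matrix m m ℂ ≃⋆ₐ[ℂ] Matrix m m ℂ) (K T : Matrix m m ℂ) :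
    φ (sylv K T) = sylv (φ K) (φ T) := by
  simp only [sylv, aut_integral, map_mul, aut_exp, aut_real_smul]

/-- A positive definite matrix is, up to a unitary conjugation, diagonal with positive entries. -/
theorem exists_aut_rdiag {K : Matrix m m ℂ} (hK : K.PosDef) :
    ∃ (U : unitary (Matrix m m ℂ)) (k : m → ℝ), (∀ i, 0 < k i) ∧
      K = Unitary.conjStarAlgAut ℂ _ U (rdiag k) :=
  ⟨hK.1.eigenvectorUnitary, hK.1.eigenvalues, hK.eigenvalues_pos, hK.1.spectral_theorem⟩

theorem integrable_of_entries {μ : Measure ℝ} {f : ℝ → Matrix m m ℂ}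
    (hf : ∀ i j, Integrable (fun x => f x i j) μ) : Integrable f μ := by
  have : f = fun x => ∑ i, ∑ j, f x i j • Matrix.single i j (1 : ℂ) := by
    ext1 x
    conv_lhs => rw [Matrix.matrix_eq_sum_single (f x)]
    simp
  rw [this]
  exact integrable_finsetSum _ fun i _ => integrable_finsetSum _ fun j _ =>
    (hf i j).smul_const _

/-- The entry map as a continuous linear map. -/
noncomputable def entryCLM (i j : m) : Matrix m m ℂ →L[ℝ] ℂ :=
  LinearMap.toContinuousLinearMap
    { toFun := fun X => X i j, map_add' := fun _ _ => rfl, map_smul' := fun _ _ => rfl }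

theorem integral_entry {μ : Measure ℝ} {f : ℝ → Matrix m m ℂ}
    (hf : ∀ i j, Integrable (fun x => f x i j) μ) (i j : m) :
    (∫ x, f x ∂μ) i j = ∫ x, f x i j ∂μ :=
  ((entryCLM i j).integral_comp_comm (integrable_of_entries hf)).symm

/-! ### The Sylvester equation -/

theorem exp_rdiag (k : m → ℝ) : NormedSpace.exp (rdiag k) = rdiag fun i => Real.exp (k i) := by
  rw [rdiag, Matrix.exp_diagonal, rdiag]
  congr 1
  ext i
  rw [Pi.coe_exp, ← Complex.exp_eq_exp_ℂ, Complex.ofReal_exp]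

theorem smul_rdiag (r : ℝ) (k : m → ℝ) : r • rdiag k = rdiag fun i => r * k i := by
  ext i j
  simp [rdiag, Matrix.diagonal_apply]

theorem sylv_rdiag_apply {k : m → ℝ} (hk : ∀ i, 0 < k i) (T : Matrix m m ℂ) (i j : m) :
    sylv (rdiag k) T i j = T i j / (k i + k j) := by
  have hpos : ∀ i j, -(k i + k j) < 0 := fun i j => by linarith [hk i, hk j]
  have he : ∀ s i j, (NormedSpace.exp ((-s) • rdiag k) * T * NormedSpace.exp ((-s) • rdiag k)) i j
      = (Real.exp (-(k i + k j) * s)) • T i j := by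
    intro s i j
    rw [smul_rdiag, exp_rdiag, mul_rdiag_apply, rdiag_mul_apply, mul_right_comm,
      ← Complex.ofReal_mul, ← Real.exp_add, Complex.real_smul]
    congr 3; ring
  have hint : ∀ i j, IntegrableOn (fun s => Real.exp (-(k i + k j) * s)) (Ioi 0) := fun i j =>
    integrableOn_exp_mul_Ioi (hpos i j) 0
  rw [sylv, integral_entry]
  · simp only [he]
    rw [integral_smul_const, integral_exp_mul_Ioi (hpos i j), Complex.real_smul]
    simp only [mul_zero, Real.exp_zero, neg_div_neg_eq]
    push_cast
    ring
  · intro i j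
    simp only [he]
    exact (hint i j).smul_const _

/-- For positive definite `K`, the integral `sylv K T` solves the Sylvester equation. -/
theorem sylv_spec {K : Matrix m m ℂ} (hK : K.PosDef) (T : Matrix m m ℂ) :
    K * sylv K T + sylv K T * K = T := by
  obtain ⟨U, k, hk, hKU⟩ := exists_aut_rdiag hK
  set φ := Unitary.conjStarAlgAut ℂ (Matrix m m ℂ) U
  have hT : T = φ (φ.symm T) := by simp
  rw [hKU, hT, ← aut_sylv, ← map_mul, ← map_mul, ← map_add]
  congr 1
  ext i j
  rw [Matrix.add_apply, rdiag_mul_apply, mul_rdiag_apply, sylv_rdiag_apply hk]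
  have : (k i : ℂ) + k j ≠ 0 := by
    rw [← Complex.ofReal_add]
    exact Complex.ofReal_ne_zero.2 (by linarith [hk i, hk j])
  field_simp

theorem sylv_eq_of {K : Matrix m m ℂ} (hK : K.PosDef) {Q T : Matrix m m ℂ}
    (h : K * Q + Q * K = T) : sylv K T = Q := by
  rw [← sub_eq_zero]
  refine eq_zero_of_sylvester hK ?_
  rw [mul_sub, sub_mul, sub_add_sub_comm, sylv_spec hK, h, sub_self]

theorem sylv_add {K : Matrix m m ℂ} (hK : K.PosDef) (S T : Matrix m m ℂ) :
    sylv K (S + T) = sylv K S + sylv K T := by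
  refine sylv_eq_of hK ?_
  rw [mul_add, add_mul, add_add_add_comm, sylv_spec hK, sylv_spec hK]

theorem sylv_zero {K : Matrix m m ℂ} (hK : K.PosDef) : sylv K 0 = 0 :=
  sylv_eq_of hK (by simp)

theorem posSemidef_sylv {K T : Matrix m m ℂ} (hK : K.IsHermitian) (hT : T.PosSemidef) :
    (sylv K T).PosSemidef := by
  rw [← Matrix.nonneg_iff_posSemidef]
  refine integral_nonneg fun s => ?_
  have h : (NormedSpace.exp ((-s) • K)).IsHermitian := (isHermitian_real_smul hK _).exp
  have := hT.mul_mul_conjTranspose_same (NormedSpace.exp ((-s) • K))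
  rw [h.eq] at this
  exact Matrix.nonneg_iff_posSemidef.2 this

/-! ### Integrals of rational functions against `√s` -/

theorem hasDerivAt_arctan_sqrt_div {a s : ℝ} (ha : 0 < a) (hs : 0 < s) :
    HasDerivAt (fun s => Real.arctan (√s / a)) (a / (2 * √s * (s + a ^ 2))) s := by
  have h := ((Real.hasDerivAt_sqrt hs.ne').div_const a).arctan
  convert! h using 1
  have h1 : 0 < √s := Real.sqrt_pos.2 hs
  rw [div_pow, Real.sq_sqrt hs.le]
  field_simp
  ring

theorem tendsto_arctan_sqrt_div {a : ℝ} (ha : 0 < a) :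
    Tendsto (fun s => Real.arctan (√s / a)) atTop (𝓝 (Real.pi / 2)) :=
  (tendsto_nhds_of_tendsto_nhdsWithin Real.tendsto_arctan_atTop).comp
    (Real.tendsto_sqrt_atTop.atTop_div_const ha)

theorem tendsto_sqrt_div_add (a : ℝ) :
    Tendsto (fun s => √s / (s + a ^ 2)) atTop (𝓝 0) := by
  refine squeeze_zero' (Eventually.filter_mono le_rfl ?_) ?_
    (tendsto_inv_atTop_zero.comp Real.tendsto_sqrt_atTop)
  · filter_upwards [eventually_gt_atTop 0] with s hs
    positivity
  · filter_upwards [eventually_gt_atTop 0] with s hs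
    have h1 : 0 < √s := Real.sqrt_pos.2 hs
    simp only [Function.comp_apply]
    rw [inv_eq_one_div, div_le_div_iff₀ (by positivity) h1, Real.mul_self_sqrt hs.le]
    nlinarith [sq_nonneg a]

theorem tendsto_sqrt_div_add_sq (a : ℝ) :
    Tendsto (fun s => √s / (s + a ^ 2) ^ 2) atTop (𝓝 0) := by
  have h2 : Tendsto (fun s : ℝ => (s + a ^ 2)⁻¹) atTop (𝓝 0) :=
    tendsto_inv_atTop_zero.comp (tendsto_atTop_add_const_right _ _ tendsto_id)
  have := (tendsto_sqrt_div_add a).mul h2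
  rw [mul_zero] at this
  refine this.congr fun s => ?_
  rw [div_mul_eq_mul_div, ← div_eq_mul_inv, div_div, ← pow_two (s + a ^ 2)]

/-- The fundamental theorem of calculus on `(0, ∞)` for a nonnegative integrand; integrability is part
of the conclusion. -/
theorem integral_of_antideriv {F f : ℝ → ℝ} {l : ℝ} (hF0 : F 0 = 0)
    (hc : ContinuousAt F 0) (hd : ∀ s, 0 < s → HasDerivAt F (f s) s)
    (hf : ∀ s, 0 < s → 0 ≤ f s) (hl : Tendsto F atTop (𝓝 l)) :
    IntegrableOn f (Ioi 0) ∧ ∫ s in Ioi 0, f s = l :=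
  ⟨integrableOn_Ioi_deriv_of_nonneg hc.continuousWithinAt hd hf hl, by
    rw [integral_Ioi_of_hasDerivAt_of_nonneg hc.continuousWithinAt hd hf hl, hF0, sub_zero]⟩

theorem integral_sqrt_two_factors {a b : ℝ} (ha : 0 < a) (hb : 0 < b) :
    IntegrableOn (fun s => √s / ((s + a ^ 2) * (s + b ^ 2))) (Ioi 0) ∧
      ∫ s in Ioi 0, √s / ((s + a ^ 2) * (s + b ^ 2)) = Real.pi / (a + b) := by
  rcases eq_or_ne a b with rfl | hab
  · refine integral_of_antideriv
      (F := fun s => Real.arctan (√s / a) / a - √s / (s + a ^ 2)) (by simp) ?_ ?_ ?_ ?_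
    · refine ContinuousAt.sub ?_ (ContinuousAt.div (by fun_prop) (by fun_prop) (by positivity))
      exact ContinuousAt.div_const (Real.continuous_arctan.continuousAt.comp (by fun_prop)) _
    · intro s hs
      have h1 : 0 < √s := Real.sqrt_pos.2 hs
      have h2 : √s ^ 2 = s := Real.sq_sqrt hs.le
      have hne : s + a ^ 2 ≠ 0 := by positivity
      convert! ((hasDerivAt_arctan_sqrt_div ha hs).div_const a).sub
        ((Real.hasDerivAt_sqrt hs.ne').div ((hasDerivAt_id s).add_const (a ^ 2)) hne) using 1
      simp only [id]
      field_simp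
      ring
    · intro s hs; positivity
    · convert! ((tendsto_arctan_sqrt_div ha).div_const a).sub (tendsto_sqrt_div_add a) using 2
      field_simp
      ring
  · have hne : a ^ 2 - b ^ 2 ≠ 0 := by
      rw [sq_sub_sq]
      exact mul_ne_zero (by positivity) (sub_ne_zero.2 hab)
    refine integral_of_antideriv
      (F := fun s => 2 / (a ^ 2 - b ^ 2) *
        (a * Real.arctan (√s / a) - b * Real.arctan (√s / b))) (by simp) ?_ ?_ ?_ ?_
    · refine ContinuousAt.mul continuousAt_const (ContinuousAt.sub ?_ ?_) <;>
      exact ContinuousAt.mul continuousAt_const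
        (Real.continuous_arctan.continuousAt.comp (by fun_prop))
    · intro s hs
      have h1 : 0 < √s := Real.sqrt_pos.2 hs
      have h2 : √s ^ 2 = s := Real.sq_sqrt hs.le
      have h3 : 0 < s + a ^ 2 := by positivity
      have h4 : 0 < s + b ^ 2 := by positivity
      convert! ((((hasDerivAt_arctan_sqrt_div ha hs).const_mul a).sub
        ((hasDerivAt_arctan_sqrt_div hb hs).const_mul b)).const_mul (2 / (a ^ 2 - b ^ 2))) using 1
      field_simp
      rw [h2]
      ring
    · intro s hs; positivity
    · convert! ((((tendsto_arctan_sqrt_div ha).const_mul a).sub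
        ((tendsto_arctan_sqrt_div hb).const_mul b)).const_mul (2 / (a ^ 2 - b ^ 2))) using 2
      have : a - b ≠ 0 := sub_ne_zero.2 hab
      rw [sq_sub_sq]
      field_simp

/-- The three-factor integral when two of the parameters differ, by partial fractions. -/
theorem integral_sqrt_three_factors_of_ne {a b c : ℝ} (ha : 0 < a) (hb : 0 < b) (hc : 0 < c)
    (hac : a ≠ c) :
    IntegrableOn (fun s => √s / ((s + a ^ 2) * (s + b ^ 2) * (s + c ^ 2))) (Ioi 0) ∧
      ∫ s in Ioi 0, √s / ((s + a ^ 2) * (s + b ^ 2) * (s + c ^ 2))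
        = Real.pi / ((a + b) * (b + c) * (c + a)) := by
  have h1 : c - a ≠ 0 := sub_ne_zero.2 hac.symm
  have hne : c ^ 2 - a ^ 2 ≠ 0 := by
    rw [sq_sub_sq]
    exact mul_ne_zero (by positivity) h1
  obtain ⟨i1, e1⟩ := integral_sqrt_two_factors ha hb
  obtain ⟨i2, e2⟩ := integral_sqrt_two_factors hc hb
  have heq : EqOn (fun s => (c ^ 2 - a ^ 2)⁻¹ *
      (√s / ((s + a ^ 2) * (s + b ^ 2)) - √s / ((s + c ^ 2) * (s + b ^ 2))))
      (fun s => √s / ((s + a ^ 2) * (s + b ^ 2) * (s + c ^ 2))) (Ioi 0) := by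
    intro s hs
    have hs : 0 < s := hs
    have h3 : 0 < s + a ^ 2 := by positivity
    have h4 : 0 < s + b ^ 2 := by positivity
    have h5 : 0 < s + c ^ 2 := by positivity
    simp only
    field_simp
    ring
  refine ⟨IntegrableOn.congr_fun ((i1.sub i2).const_mul _) heq measurableSet_Ioi, ?_⟩
  rw [← setIntegral_congr_fun measurableSet_Ioi heq, integral_const_mul, integral_sub i1 i2, e1,
    e2, sq_sub_sq]
  field_simp
  ring

theorem integral_sqrt_three_factors {a b c : ℝ} (ha : 0 < a) (hb : 0 < b) (hc : 0 < c) :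
    IntegrableOn (fun s => √s / ((s + a ^ 2) * (s + b ^ 2) * (s + c ^ 2))) (Ioi 0) ∧
      ∫ s in Ioi 0, √s / ((s + a ^ 2) * (s + b ^ 2) * (s + c ^ 2))
        = Real.pi / ((a + b) * (b + c) * (c + a)) := by
  rcases ne_or_eq a c with hac | rfl
  · exact integral_sqrt_three_factors_of_ne ha hb hc hac
  rcases ne_or_eq a b with hab | rfl
  · have := integral_sqrt_three_factors_of_ne ha ha hb hab
    simp only [mul_right_comm _ (_ + b ^ 2)]
    convert! this using 2
    congr 1
    ring
  -- Three equal parameters: partial fractions are not available, but there is an antiderivative.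
  · refine integral_of_antideriv
      (F := fun s => Real.arctan (√s / a) / (4 * a ^ 3) + √s / (s + a ^ 2) / (4 * a ^ 2)
        - √s / (s + a ^ 2) ^ 2 / 2) (by simp) ?_ ?_ ?_ ?_
    · refine ContinuousAt.sub (ContinuousAt.add ?_ ?_) ?_
      · exact ContinuousAt.div_const (Real.continuous_arctan.continuousAt.comp (by fun_prop)) _
      · exact ContinuousAt.div_const
          (ContinuousAt.div (by fun_prop) (by fun_prop) (by positivity)) _
      · exact ContinuousAt.div_const
          (ContinuousAt.div (by fun_prop) (by fun_prop) (by positivity)) _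
    · intro s hs
      have h1 : 0 < √s := Real.sqrt_pos.2 hs
      have h2 : √s ^ 2 = s := Real.sq_sqrt hs.le
      have h3 : 0 < s + a ^ 2 := by positivity
      have hd := (hasDerivAt_id s).add_const (a ^ 2)
      convert! (((hasDerivAt_arctan_sqrt_div ha hs).div_const (4 * a ^ 3)).add
        (((Real.hasDerivAt_sqrt hs.ne').div hd h3.ne').div_const (4 * a ^ 2))).sub
        (((Real.hasDerivAt_sqrt hs.ne').div (hd.pow 2) (pow_pos h3 2).ne').div_const 2) using 1
      simp only [id, Pi.pow_apply]
      field_simp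
      simp only [mul_add, mul_sub, h2]
      ring
    · intro s hs; positivity
    · convert! (((tendsto_arctan_sqrt_div ha).div_const (4 * a ^ 3)).add
        ((tendsto_sqrt_div_add a).div_const (4 * a ^ 2))).sub
        ((tendsto_sqrt_div_add_sq a).div_const 2) using 2
      field_simp
      ring

/-- The three-factor integral with numerator `√s (s + β)`, from `s + β = (s + a²) + (β - a²)`. -/
theorem integral_sqrt_mul_add {a b c : ℝ} (ha : 0 < a) (hb : 0 < b) (hc : 0 < c) (β : ℝ) :
    IntegrableOn (fun s => √s * (s + β) / ((s + a ^ 2) * (s + b ^ 2) * (s + c ^ 2))) (Ioi 0) ∧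
      ∫ s in Ioi 0, √s * (s + β) / ((s + a ^ 2) * (s + b ^ 2) * (s + c ^ 2))
        = Real.pi * ((a * b + b * c + c * a + β) / ((a + b) * (b + c) * (c + a))) := by
  obtain ⟨i1, e1⟩ := integral_sqrt_two_factors hb hc
  obtain ⟨i2, e2⟩ := integral_sqrt_three_factors ha hb hc
  have heq : EqOn (fun s => √s / ((s + b ^ 2) * (s + c ^ 2)) +
      (β - a ^ 2) * (√s / ((s + a ^ 2) * (s + b ^ 2) * (s + c ^ 2))))
      (fun s => √s * (s + β) / ((s + a ^ 2) * (s + b ^ 2) * (s + c ^ 2))) (Ioi 0) := by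
    intro s hs
    have hs : 0 < s := hs
    have h3 : 0 < s + a ^ 2 := by positivity
    have h4 : 0 < s + b ^ 2 := by positivity
    have h5 : 0 < s + c ^ 2 := by positivity
    simp only
    field_simp
    ring
  refine ⟨IntegrableOn.congr_fun (i1.add (i2.const_mul _)) heq measurableSet_Ioi, ?_⟩
  rw [← setIntegral_congr_fun measurableSet_Ioi heq, integral_add i1 (i2.const_mul _),
    integral_const_mul, e1, e2]
  field_simp
  ring

/-! ### The matrix `Cross` in a common eigenbasis -/

theorem aut_mpow (φ : Matrix m m ℂ ≃⋆ₐ[ℂ] Matrix m m ℂ) {A : Matrix m m ℂ} (hA : A.IsHermitian)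
    (r : ℝ) : φ (mpow A r) = mpow (φ A) r :=
  aut_cfc φ _ hA

theorem aut_conjTranspose (φ : Matrix m m ℂ ≃⋆ₐ[ℂ] Matrix m m ℂ) (X : Matrix m m ℂ) :
    φ Xᴴ = (φ X)ᴴ := map_star φ X

/-- `Cross` is covariant under unitary conjugation. -/
theorem aut_Cross (φ : Matrix m m ℂ ≃⋆ₐ[ℂ] Matrix m m ℂ) {A B : Matrix m m ℂ}
    (hA : A.IsHermitian) (hB : B.IsHermitian) (X Z : Matrix m m ℂ) :
    φ (Cross A B X Z) = Cross (φ A) (φ B) (φ X) (φ Z) := by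
  have hm : ∀ r, φ (mpow ((1 / 2 : ℝ) • (A + B)) r) = mpow ((1 / 2 : ℝ) • (φ A + φ B)) r := by
    intro r
    rw [aut_mpow φ (isHermitian_real_smul (hA.add hB) _), aut_real_smul, map_add]
  have hmid : ∀ Y, φ (midConj A B Y) = midConj (φ A) (φ B) (φ Y) := by
    intro Y; simp only [midConj, map_mul, hm]
  have hpsi : φ (psi A B) = psi (φ A) (φ B) := by
    simp only [psi, hmid, aut_real_smul, map_sub]
  have hE : φ (E₂₁ A B X Z) = E₂₁ (φ A) (φ B) (φ X) (φ Z) := by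
    simp only [E₂₁, E₁, E₂, map_add, map_mul, map_neg, hmid, hpsi, aut_real_smul, map_sub]
  have hO : ∀ s, φ (Omega A B X Z s) = Omega (φ A) (φ B) (φ X) (φ Z) s := by
    intro s; simp only [Omega, map_add, map_mul, aut_real_smul, hE, hpsi]
  have ht : ∀ s, φ (psiTilde A B s) = psiTilde (φ A) (φ B) s := by
    intro s
    have h := (autCLE φ).map_tsum (L := SummationFilter.unconditional ℕ)
      (f := fun k : ℕ => ((1 + s)⁻¹ ^ k) • psi A B ^ (2 * k))
    simp only [autCLE_apply, aut_real_smul, map_pow, hpsi] at h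
    exact h
  simp only [Cross, aut_real_smul, map_mul, map_add, hm, hpsi, aut_integral, hE, hO, ht,
    aut_conjTranspose]

theorem rdiag_eq_exp {k : m → ℝ} (hk : ∀ i, 0 < k i) :
    rdiag k = NormedSpace.exp (rdiag fun i => Real.log (k i)) := by
  rw [exp_rdiag]
  congr 1
  ext i
  rw [Real.exp_log (hk i)]

theorem posDef_rdiag {k : m → ℝ} (hk : ∀ i, 0 < k i) : (rdiag k).PosDef := by
  rw [rdiag_eq_exp hk]
  exact posDef_exp (isHermitian_rdiag _)

theorem mpow_rdiag {k : m → ℝ} (hk : ∀ i, 0 < k i) (r : ℝ) :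
    mpow (rdiag k) r = rdiag fun i => k i ^ r := by
  rw [mpow_eq_exp (posDef_rdiag hk)]
  nth_rw 1 [rdiag_eq_exp hk]
  rw [mlog_exp (isHermitian_rdiag _), smul_rdiag, exp_rdiag]
  congr 1
  ext i
  rw [Real.rpow_def_of_pos (hk i), mul_comm]

theorem rdiag_add (k l : m → ℝ) : rdiag k + rdiag l = rdiag fun i => k i + l i := by
  ext i j; by_cases h : i = j <;> simp [rdiag, h]

theorem rdiag_sub (k l : m → ℝ) : rdiag k - rdiag l = rdiag fun i => k i - l i := by
  ext i j; by_cases h : i = j <;> simp [rdiag, h]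

theorem rdiag_pow (k : m → ℝ) (d : ℕ) : rdiag k ^ d = rdiag fun i => k i ^ d := by
  simp only [rdiag, Matrix.diagonal_pow]
  congr 1
  ext i
  simp

/-- The contribution of the first integral in `Cross` to the coefficient of `R i k * star (R j k)`,
in an eigenbasis where `ψ` has eigenvalues `p`, `q`, `t` at the indices `i`, `j`, `k`. -/
noncomputable def crossKernel₁ (p q t s : ℝ) : ℝ :=
  √s * ((1 + s + p * t) * (1 + s + q * t)) /
    ((1 + s) * ((1 + s - p ^ 2) * (1 + s - q ^ 2) * (1 + s - t ^ 2)))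

/-- The corresponding contribution of the second integral in `Cross`. -/
noncomputable def crossKernel₂ (p q s : ℝ) : ℝ :=
  √s / ((1 + s) * ((1 + s - p ^ 2) * (1 + s - q ^ 2)))

theorem integrableOn_crossKernel₂ {p q : ℝ} (hp : p ^ 2 < 1) (hq : q ^ 2 < 1) :
    IntegrableOn (crossKernel₂ p q) (Ioi 0) := by
  have h1 : 0 < 1 - p ^ 2 := by linarith
  have h2 : 0 < 1 - q ^ 2 := by linarith
  obtain ⟨i1, -⟩ := integral_sqrt_three_factors (Real.sqrt_pos.2 h1) (Real.sqrt_pos.2 h2) one_pos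
  refine i1.congr_fun (fun s hs => ?_) measurableSet_Ioi
  have hs : 0 < s := hs
  simp only [crossKernel₂]
  rw [Real.sq_sqrt h1.le, Real.sq_sqrt h2.le]
  congr 1
  ring

/-- The two kernels combine into a single rational function against `√s`, because
`(1 + s + pt)(1 + s + qt) + pq(1 + s - t²) = (1 + s)(1 + s + pq + pt + qt)`. -/
theorem integral_crossKernel {x y z : ℝ} (hx : 0 < x) (hy : 0 < y) (hz : 0 < z) {p q t : ℝ}
    (hp : p = (1 - x ^ 2) / (1 + x ^ 2)) (hq : q = (1 - y ^ 2) / (1 + y ^ 2))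
    (ht : t = (1 - z ^ 2) / (1 + z ^ 2)) :
    IntegrableOn (crossKernel₁ p q t) (Ioi 0) ∧
      (∫ s in Ioi 0, crossKernel₁ p q t s) + p * q * ∫ s in Ioi 0, crossKernel₂ p q s
        = Real.pi * (4 * ((1 + x ^ 2) / 2) * ((1 + y ^ 2) / 2) * ((1 + z ^ 2) / 2) /
          ((x + y) * (y + z) * (z + x))) := by
  have hc : ∀ {r ρ : ℝ}, ρ = (1 - r ^ 2) / (1 + r ^ 2) →
      (2 * r / (1 + r ^ 2)) ^ 2 = 1 - ρ ^ 2 := by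
    rintro r ρ rfl
    have : 1 + r ^ 2 ≠ 0 := by positivity
    field_simp
    ring
  have hlt : ∀ {r ρ : ℝ}, 0 < r → ρ = (1 - r ^ 2) / (1 + r ^ 2) → ρ ^ 2 < 1 := by
    intro r ρ hr hρ
    have h1 := hc hρ
    have : 0 < (2 * r / (1 + r ^ 2)) ^ 2 := by positivity
    linarith
  obtain ⟨i, e⟩ := integral_sqrt_mul_add (a := 2 * x / (1 + x ^ 2)) (b := 2 * y / (1 + y ^ 2))
    (c := 2 * z / (1 + z ^ 2)) (by positivity) (by positivity) (by positivity)
    (1 + (p * q + q * t + t * p))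
  rw [hc hp, hc hq, hc ht] at i e
  have i2 := integrableOn_crossKernel₂ (hlt hx hp) (hlt hy hq)
  have heq : EqOn (fun s => √s * (s + (1 + (p * q + q * t + t * p))) /
      ((s + (1 - p ^ 2)) * (s + (1 - q ^ 2)) * (s + (1 - t ^ 2))) - p * q * crossKernel₂ p q s)
      (crossKernel₁ p q t) (Ioi 0) := by
    intro s hs
    have hs : 0 < s := hs
    have h0 : 0 < 1 + s := by linarith
    have h1 : 0 < 1 + s - p ^ 2 := by linarith [hlt hx hp]
    have h2 : 0 < 1 + s - q ^ 2 := by linarith [hlt hy hq]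
    have h3 : 0 < 1 + s - t ^ 2 := by linarith [hlt hz ht]
    simp only [crossKernel₁, crossKernel₂]
    rw [show s + (1 - p ^ 2) = 1 + s - p ^ 2 by ring, show s + (1 - q ^ 2) = 1 + s - q ^ 2 by ring,
      show s + (1 - t ^ 2) = 1 + s - t ^ 2 by ring]
    field_simp
    ring
  -- With `p = (1 - x²) / (1 + x²)` one has `√(1 - p²) = 2x / (1 + x²)`; what remains is algebra.
  refine ⟨IntegrableOn.congr_fun (i.sub (i2.const_mul _)) heq measurableSet_Ioi, ?_⟩
  rw [← setIntegral_congr_fun measurableSet_Ioi heq, integral_sub i (i2.const_mul _),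
    integral_const_mul, sub_add_cancel, e]
  congr 1
  have h1 : 2 * x / (1 + x ^ 2) + 2 * y / (1 + y ^ 2)
      = 2 * (x + y) * (1 + x * y) / ((1 + x ^ 2) * (1 + y ^ 2)) := by field_simp; ring
  have h2 : 2 * y / (1 + y ^ 2) + 2 * z / (1 + z ^ 2)
      = 2 * (y + z) * (1 + y * z) / ((1 + y ^ 2) * (1 + z ^ 2)) := by field_simp; ring
  have h3 : 2 * z / (1 + z ^ 2) + 2 * x / (1 + x ^ 2)
      = 2 * (z + x) * (1 + z * x) / ((1 + z ^ 2) * (1 + x ^ 2)) := by field_simp; ring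
  rw [h1, h2, h3, hp, hq, ht]
  field_simp
  ring

/-- In an eigenbasis of the commuting matrices `A = diag a` and `B = diag (a r²)`, the entries of
`Cross` are explicit rational expressions. -/
theorem Cross_rdiag_apply {a r : m → ℝ} (ha : ∀ i, 0 < a i) (hr : ∀ i, 0 < r i)
    (X Z : Matrix m m ℂ) (i j : m) :
    Cross (rdiag a) (rdiag fun i => a i * r i * r i) X Z i j =
      ∑ k, ((Z i k - r i ^ 2 * X i k) / (r i + r k)) * star ((Z j k - r j ^ 2 * X j k) / (r j + r k))
        / (a k * (r i + r j)) := by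
  set A := rdiag a
  set B := rdiag fun i => a i * r i * r i
  -- `μ` and `p` are the eigenvalues of `M = (A + B) / 2` and of `ψ`; `u` and `w` are those of
  -- `M ^ (-1/2)` and `M ^ (1/2)`.
  set μ : m → ℝ := fun i => 1 / 2 * (a i + a i * r i * r i) with hμ
  set p : m → ℝ := fun i => (1 - r i ^ 2) / (1 + r i ^ 2) with hp
  have hμpos : ∀ i, 0 < μ i := fun i => by have := ha i; have := hr i; simp only [hμ]; positivity
  have hM : (1 / 2 : ℝ) • (A + B) = rdiag μ := by
    rw [rdiag_add, smul_rdiag]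
  set u : m → ℝ := fun i => μ i ^ (-1 / 2 : ℝ) with hu
  set w : m → ℝ := fun i => μ i ^ (1 / 2 : ℝ) with hw
  have hMu : mpow ((1 / 2 : ℝ) • (A + B)) (-1 / 2) = rdiag u := by rw [hM, mpow_rdiag hμpos]
  have hMw : mpow ((1 / 2 : ℝ) • (A + B)) (1 / 2) = rdiag w := by rw [hM, mpow_rdiag hμpos]
  have huw : ∀ i, w i * u i = 1 := fun i => by
    simp only [hu, hw]; rw [← Real.rpow_add (hμpos i)]; norm_num
  have huu : ∀ i, u i * u i * μ i = 1 := fun i => by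
    simp only [hu]
    nth_rw 3 [← Real.rpow_one (μ i)]
    rw [← Real.rpow_add (hμpos i), ← Real.rpow_add (hμpos i)]; norm_num
  have huuμ : ∀ i, u i * u i = (μ i)⁻¹ := fun i => eq_inv_of_mul_eq_one_left (huu i)
  have hpsi : psi A B = rdiag p := by
    rw [psi, midConj, hMu, rdiag_sub, smul_rdiag, rdiag_mul_rdiag, rdiag_mul_rdiag]
    congr 1
    ext i
    rw [mul_right_comm, huuμ]
    simp only [hμ, hp]
    have h1 := (ha i).ne'
    have h2 : 1 + r i ^ 2 ≠ 0 := by positivity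
    have h3 : a i + a i * r i * r i = a i * (1 + r i ^ 2) := by ring
    rw [h3]
    field_simp
  have hp1 : ∀ i, p i ^ 2 < 1 := fun i => by
    simp only [hp]
    rw [div_pow, div_lt_one (by positivity)]
    nlinarith [pow_pos (hr i) 2]
  have hden : ∀ (s : ℝ), 0 < s → ∀ i, 0 < 1 + s - p i ^ 2 := fun s hs i => by linarith [hp1 i]
  -- `R` is `E₂ + ψ E₁`.
  set R := E₂₁ A B X Z with hRdef
  have hR : ∀ i k, R i k = -((u i * u k * (a i / (2 * μ i)) : ℝ) : ℂ) *
      (Z i k - r i ^ 2 * X i k) := by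
    intro i k
    have h1 : (a i : ℂ) ≠ 0 := Complex.ofReal_ne_zero.2 (ha i).ne'
    have h2 : (1 + (r i : ℂ) ^ 2) ≠ 0 := by
      have : 1 + r i ^ 2 ≠ 0 := by positivity
      exact_mod_cast this
    have h3 : (μ i : ℂ) = 1 / 2 * (a i * (1 + r i ^ 2)) := by
      simp only [hμ]; push_cast; ring
    simp only [hRdef, E₂₁, E₁, E₂, hpsi, midConj, hMu, Matrix.add_apply, rdiag_mul_apply,
      mul_rdiag_apply, Matrix.neg_apply, Matrix.smul_apply, Matrix.sub_apply, Complex.real_smul]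
    push_cast
    rw [h3]
    simp only [hp]
    push_cast
    field_simp
    ring
  have hT : ∀ s, 0 < s → psiTilde A B s = rdiag fun i => (1 + s) / (1 + s - p i ^ 2) := by
    intro s hs
    have h0 : 0 < 1 + s := by linarith
    have hterm : ∀ k : ℕ, ((1 + s)⁻¹ ^ k) • psi A B ^ (2 * k)
        = rdiag fun i => ((1 + s)⁻¹ * p i ^ 2) ^ k := by
      intro k
      rw [hpsi, rdiag_pow, smul_rdiag]
      congr 1; ext i; rw [mul_pow, pow_mul]
    have hsum : HasSum (fun k : ℕ => rdiag fun i => ((1 + s)⁻¹ * p i ^ 2) ^ k)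
        (rdiag fun i => (1 + s) / (1 + s - p i ^ 2)) := by
      refine HasSum.matrix_diagonal (Pi.hasSum.2 fun i => Complex.hasSum_ofReal.2 ?_)
      have hlt : (1 + s)⁻¹ * p i ^ 2 < 1 := by
        rw [inv_mul_lt_iff₀ h0]; linarith [hp1 i]
      convert! hasSum_geometric_of_lt_one (by positivity) hlt using 1
      have := hden s hs i
      field_simp
    rw [psiTilde]
    simp only [hterm]
    exact hsum.tsum_eq
  have hO : ∀ s, 0 < s → ∀ i k, Omega A B X Z s i k =
      (((1 + s) ^ (-1 / 2 : ℝ) * (1 + p i * p k / (1 + s)) : ℝ) : ℂ) * R i k := by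
    intro s hs i k
    have h0 : 0 < 1 + s := by linarith
    have h1 : (1 + s) ^ (-1 - 1 / 2 : ℝ) = (1 + s) ^ (-1 / 2 : ℝ) * (1 + s)⁻¹ := by
      rw [← Real.rpow_neg_one, ← Real.rpow_add h0]; norm_num
    simp only [Omega, hpsi, Matrix.add_apply, Matrix.smul_apply, mul_rdiag_apply, rdiag_mul_apply,
      Complex.real_smul, h1, ← hRdef]
    push_cast
    ring
  -- The entries of the two integrands, in terms of the scalar kernels.
  have hM1 : EqOn (fun s => (s ^ (1 / 2 : ℝ) * (1 + s)⁻¹) •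
      (psiTilde A B s * Omega A B X Z s * psiTilde A B s * (Omega A B X Z s)ᴴ * psiTilde A B s))
      (fun s => Matrix.of fun i j => ∑ k, (crossKernel₁ (p i) (p j) (p k) s : ℂ) *
        (R i k * star (R j k))) (Ioi 0) := by
    intro s hs
    have hs : 0 < s := hs
    have h0 : 0 < 1 + s := by linarith
    ext i j
    simp only [Matrix.smul_apply, hT s hs, mul_rdiag_apply, Matrix.of_apply]
    rw [Matrix.mul_apply]
    simp only [mul_rdiag_apply, rdiag_mul_apply, Matrix.conjTranspose_apply, hO s hs, star_mul',
      Complex.real_smul, Finset.sum_mul, Finset.mul_sum]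
    refine Finset.sum_congr rfl fun k _ => ?_
    have hq2 : (1 + s) ^ (-1 / 2 : ℝ) * (1 + s) ^ (-1 / 2 : ℝ) = (1 + s)⁻¹ := by
      rw [← Real.rpow_add h0, ← Real.rpow_neg_one]; norm_num
    set q := (1 + s) ^ (-1 / 2 : ℝ)
    have h1 := hden s hs i
    have h2 := hden s hs j
    have h3 := hden s hs k
    have key : crossKernel₁ (p i) (p j) (p k) s = s ^ (1 / 2 : ℝ) * (1 + s)⁻¹ *
        ((1 + s) / (1 + s - p i ^ 2) * (q * (1 + p i * p k / (1 + s))) *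
          ((1 + s) / (1 + s - p k ^ 2)) * (q * (1 + p j * p k / (1 + s))) *
          ((1 + s) / (1 + s - p j ^ 2))) := by
      rw [crossKernel₁, ← Real.sqrt_eq_rpow]
      have : q ^ 2 = (1 + s)⁻¹ := by rw [pow_two, hq2]
      field_simp
      rw [this]
      field_simp
    rw [key]
    simp only [Complex.star_def, Complex.conj_ofReal]
    push_cast
    ring
  have hM2 : EqOn (fun s => (s ^ (1 / 2 : ℝ) * ((1 + s) ^ 3)⁻¹) •
      (psiTilde A B s * R * Rᴴ * psiTilde A B s))
      (fun s => Matrix.of fun i j => ∑ k, (crossKernel₂ (p i) (p j) s : ℂ) *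
        (R i k * star (R j k))) (Ioi 0) := by
    intro s hs
    have hs : 0 < s := hs
    have h0 : 0 < 1 + s := by linarith
    ext i j
    simp only [Matrix.smul_apply, hT s hs, mul_rdiag_apply, Matrix.of_apply]
    rw [Matrix.mul_apply]
    simp only [rdiag_mul_apply, Matrix.conjTranspose_apply, Complex.real_smul, Finset.sum_mul,
      Finset.mul_sum]
    refine Finset.sum_congr rfl fun k _ => ?_
    have h1 := hden s hs i
    have h2 := hden s hs j
    have key : crossKernel₂ (p i) (p j) s = s ^ (1 / 2 : ℝ) * ((1 + s) ^ 3)⁻¹ *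
        ((1 + s) / (1 + s - p i ^ 2) * ((1 + s) / (1 + s - p j ^ 2))) := by
      rw [crossKernel₂, ← Real.sqrt_eq_rpow]
      field_simp
    rw [key]
    push_cast
    ring
  have hker : ∀ i j k, _ := fun i j k => integral_crossKernel (hr i) (hr j) (hr k)
    (rfl : p i = _) (rfl : p j = _) (rfl : p k = _)
  have hint1 : ∀ i j k, Integrable (fun s => (crossKernel₁ (p i) (p j) (p k) s : ℂ) *
      (R i k * star (R j k))) (volume.restrict (Ioi 0)) := fun i j k =>
    ((hker i j k).1.integrable.ofReal).mul_const _
  have hint2 : ∀ i j k, Integrable (fun s => (crossKernel₂ (p i) (p j) s : ℂ) *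
      (R i k * star (R j k))) (volume.restrict (Ioi 0)) := fun i j k =>
    ((integrableOn_crossKernel₂ (hp1 i) (hp1 j)).integrable.ofReal).mul_const _
  have e1 : (∫ s in Ioi (0 : ℝ), (s ^ (1 / 2 : ℝ) * (1 + s)⁻¹) •
      (psiTilde A B s * Omega A B X Z s * psiTilde A B s * (Omega A B X Z s)ᴴ * psiTilde A B s)) i j
      = ∑ k, ((∫ s in Ioi (0 : ℝ), crossKernel₁ (p i) (p j) (p k) s : ℝ) : ℂ) *
        (R i k * star (R j k)) := by
    rw [setIntegral_congr_fun measurableSet_Ioi hM1, integral_entry]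
    · simp only [Matrix.of_apply]
      rw [integral_finsetSum _ fun k _ => hint1 i j k]
      simp only [integral_mul_const, integral_complex_ofReal]
    · intro i j
      exact integrable_finsetSum _ fun k _ => hint1 i j k
  have e2 : (∫ s in Ioi (0 : ℝ), (s ^ (1 / 2 : ℝ) * ((1 + s) ^ 3)⁻¹) •
      (psiTilde A B s * R * Rᴴ * psiTilde A B s)) i j
      = ∑ k, ((∫ s in Ioi (0 : ℝ), crossKernel₂ (p i) (p j) s : ℝ) : ℂ) *
        (R i k * star (R j k)) := by
    rw [setIntegral_congr_fun measurableSet_Ioi hM2, integral_entry]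
    · simp only [Matrix.of_apply]
      rw [integral_finsetSum _ fun k _ => hint2 i j k]
      simp only [integral_mul_const, integral_complex_ofReal]
    · intro i j
      exact integrable_finsetSum _ fun k _ => hint2 i j k
  rw [Cross, Matrix.smul_apply, hMw, mul_rdiag_apply, rdiag_mul_apply, Matrix.add_apply, hpsi,
    mul_rdiag_apply, rdiag_mul_apply, e1, e2, Finset.mul_sum, Finset.sum_mul,
    ← Finset.sum_add_distrib, Finset.mul_sum, Finset.sum_mul, Finset.smul_sum]
  refine Finset.sum_congr rfl fun k _ => ?_
  have hk := (hker i j k).2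
  set I1 := ∫ s in Ioi (0 : ℝ), crossKernel₁ (p i) (p j) (p k) s
  set I2 := ∫ s in Ioi (0 : ℝ), crossKernel₂ (p i) (p j) s
  have hkC := congrArg (fun x : ℝ => (x : ℂ)) hk
  set κ : ℝ := 4 * ((1 + r i ^ 2) / 2) * ((1 + r j ^ 2) / 2) * ((1 + r k ^ 2) / 2) /
          ((r i + r j) * (r j + r k) * (r k + r i)) with hκ
  have hpi : (Real.pi : ℂ) ≠ 0 := Complex.ofReal_ne_zero.2 Real.pi_ne_zero
  have step : (1 / Real.pi : ℝ) • ((w i : ℂ) * ((I1 : ℂ) * (R i k * star (R j k)) +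
      (p i : ℂ) * ((I2 : ℂ) * (R i k * star (R j k))) * (p j : ℂ)) * (w j : ℂ))
      = (w i * w j * κ : ℝ) * (R i k * star (R j k)) := by
    push_cast at hkC
    rw [Complex.real_smul]
    push_cast
    have : (1 / (Real.pi : ℂ)) * (w i * (I1 * (R i k * star (R j k)) +
        p i * (I2 * (R i k * star (R j k))) * p j) * w j)
        = (1 / (Real.pi : ℂ)) * (I1 + p i * p j * I2) * (w i * w j * (R i k * star (R j k))) := by
      ring
    rw [this, hkC]
    field_simp
  -- All powers of the eigenvalues of `M` cancel.
  have hcoef : w i * w j * κ * (u i * u k * (a i / (2 * μ i))) * (u j * u k * (a j / (2 * μ j)))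
      = 1 / ((r i + r k) * (r j + r k) * (a k * (r i + r j))) := by
    have h1 : w i * w j * κ * (u i * u k * (a i / (2 * μ i))) * (u j * u k * (a j / (2 * μ j)))
      = (w i * u i) * (w j * u j) * (u k * u k) * κ * (a i / (2 * μ i)) * (a j / (2 * μ j)) := by
      ring
    have h2 : ∀ i, μ i = 1 / 2 * (a i * (1 + r i ^ 2)) := fun i => by simp only [hμ]; ring
    rw [h1, huw, huw, huuμ, hκ, h2 i, h2 j, h2 k]
    have := ha i; have := ha j; have := ha k; have := hr i; have := hr j; have := hr k
    field_simp
    ring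
  have hcoefC := congrArg (fun x : ℝ => (x : ℂ)) hcoef
  push_cast at hcoefC
  refine step.trans ?_
  rw [hR, hR]
  simp only [star_mul', star_neg, star_div₀, Complex.star_def, Complex.conj_ofReal, map_add]
  push_cast
  calc _ = (w i * w j * κ * (u i * u k * (a i / (2 * μ i))) * (u j * u k * (a j / (2 * μ j))) : ℂ) *
        ((Z i k - r i ^ 2 * X i k) * (starRingEnd ℂ) (Z j k - r j ^ 2 * X j k)) := by ring
    _ = _ := by rw [hcoefC, one_div, mul_inv, mul_inv]; simp only [div_eq_mul_inv]; ring

/-- The Sylvester equation that characterizes `Cross` when `A` and `B = A K²` commute: `Y` is the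
solution of `K Y + Y K = Z - K² X`, and `T = Y A⁻¹`. -/
theorem Cross_sylvester {U : unitary (Matrix m m ℂ)} {a r : m → ℝ} (ha : ∀ i, 0 < a i)
    (hr : ∀ i, 0 < r i) {A B K X Y Z T : Matrix m m ℂ}
    (hA : A = Unitary.conjStarAlgAut ℂ _ U (rdiag a))
    (hK : K = Unitary.conjStarAlgAut ℂ _ U (rdiag r)) (hB : B = A * K * K)
    (hY : K * Y + Y * K = Z - K * K * X) (hT : T * A = Y) :
    K * Cross A B X Z + Cross A B X Z * K = T * Yᴴ := by
  set φ := Unitary.conjStarAlgAut ℂ (Matrix m m ℂ) U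
  have hsurj : ∀ X, ∃ X', φ X' = X := fun X => ⟨φ.symm X, by simp⟩
  obtain ⟨X, rfl⟩ := hsurj X
  obtain ⟨Y, rfl⟩ := hsurj Y
  obtain ⟨Z, rfl⟩ := hsurj Z
  obtain ⟨T, rfl⟩ := hsurj T
  have hB' : B = φ (rdiag fun i => a i * r i * r i) := by
    rw [hB, hA, hK, ← map_mul, ← map_mul, rdiag_mul_rdiag, rdiag_mul_rdiag]
  rw [hA, hK] at *
  rw [hB', ← aut_Cross φ (isHermitian_rdiag _) (isHermitian_rdiag _), ← aut_conjTranspose]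
  simp only [← map_mul, ← map_sub, ← map_add] at hY hT ⊢
  have hY := φ.injective hY
  have hT := φ.injective hT
  congr 1
  have hrr : ∀ i j, (r i : ℂ) + r j ≠ 0 := fun i j => by
    rw [← Complex.ofReal_add]
    exact Complex.ofReal_ne_zero.2 (by linarith [hr i, hr j])
  have hYe : ∀ i j, (Z i j - r i ^ 2 * X i j) / (r i + r j) = Y i j := by
    intro i j
    have := congrFun (congrFun hY i) j
    rw [Matrix.add_apply, rdiag_mul_apply, mul_rdiag_apply, Matrix.sub_apply, rdiag_mul_rdiag,
      rdiag_mul_apply] at this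
    rw [div_eq_iff (hrr i j)]
    push_cast at this
    linear_combination -this
  have hTe : ∀ i j, T i j = Y i j / a j := by
    intro i j
    have := congrFun (congrFun hT i) j
    rw [mul_rdiag_apply] at this
    rw [← this, mul_div_cancel_right₀ _ (Complex.ofReal_ne_zero.2 (ha j).ne')]
  ext i j
  rw [Matrix.add_apply, rdiag_mul_apply, mul_rdiag_apply, Cross_rdiag_apply ha hr, mul_comm,
    ← mul_add, Finset.sum_mul, Matrix.mul_apply]
  refine Finset.sum_congr rfl fun k _ => ?_
  rw [hYe, hYe, hTe, Matrix.conjTranspose_apply]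
  have h1 := hrr i j
  have h2 : (a k : ℂ) ≠ 0 := Complex.ofReal_ne_zero.2 (ha k).ne'
  field_simp

/-! ### Partial derivatives of analytic functions of two real variables -/

section Partial

variable {E : Type*} [NormedAddCommGroup E] [NormedSpace ℝ E]

/-- The partial derivative in the first variable. -/
noncomputable def pd₁ (f : ℝ × ℝ → E) (p : ℝ × ℝ) : E := fderiv ℝ f p (1, 0)

/-- The partial derivative in the second variable. -/
noncomputable def pd₂ (f : ℝ × ℝ → E) (p : ℝ × ℝ) : E := fderiv ℝ f p (0, 1)

variable {f g : ℝ × ℝ → E} {x y : ℝ}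

theorem contDiffAt_fderiv_apply {p : ℝ × ℝ} (hf : ContDiffAt ℝ ω f p) (v : ℝ × ℝ) :
    ContDiffAt ℝ ω (fun q => fderiv ℝ f q v) p :=
  (hf.fderiv_right (m := ω) (by simp)).clm_apply contDiffAt_const

theorem contDiffAt_pd₁ {p : ℝ × ℝ} (hf : ContDiffAt ℝ ω f p) : ContDiffAt ℝ ω (pd₁ f) p :=
  contDiffAt_fderiv_apply hf _

theorem contDiffAt_pd₂ {p : ℝ × ℝ} (hf : ContDiffAt ℝ ω f p) : ContDiffAt ℝ ω (pd₂ f) p :=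
  contDiffAt_fderiv_apply hf _

theorem hasDerivAt_fst (hf : ContDiffAt ℝ ω f (x, y)) :
    HasDerivAt (fun x => f (x, y)) (pd₁ f (x, y)) x :=
  (hf.differentiableAt (by simp)).hasFDerivAt.comp_hasDerivAt x
    ((hasDerivAt_id x).prodMk (hasDerivAt_const x y))

theorem hasDerivAt_snd (hf : ContDiffAt ℝ ω f (x, y)) :
    HasDerivAt (fun y => f (x, y)) (pd₂ f (x, y)) y :=
  (hf.differentiableAt (by simp)).hasFDerivAt.comp_hasDerivAt y
    ((hasDerivAt_const y x).prodMk (hasDerivAt_id y))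

/-- Equality of mixed partial derivatives. -/
theorem pd₁_pd₂ {p : ℝ × ℝ} (hf : ContDiffAt ℝ ω f p) : pd₁ (pd₂ f) p = pd₂ (pd₁ f) p := by
  have h : DifferentiableAt ℝ (fderiv ℝ f) p :=
    (hf.fderiv_right (m := ω) (by simp)).differentiableAt (by simp)
  have hs := hf.isSymmSndFDerivAt_of_omega (1, 0) (0, 1)
  have key : ∀ v w : ℝ × ℝ, fderiv ℝ (fun q => fderiv ℝ f q w) p v
      = fderiv ℝ (fderiv ℝ f) p v w := by
    intro v w
    rw [fderiv_clm_apply h (differentiableAt_const w)]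
    simp
  change fderiv ℝ (fun q => fderiv ℝ f q (0, 1)) p (1, 0)
    = fderiv ℝ (fun q => fderiv ℝ f q (1, 0)) p (0, 1)
  rw [key, key, hs]

theorem pd₂_congr {p : ℝ × ℝ} (h : f =ᶠ[𝓝 p] g) : pd₂ f p = pd₂ g p := by
  simp only [pd₂, h.fderiv_eq]

/-- The first partial derivative commutes with the second derivative in the other variable. -/
theorem pd₁_pd₂_pd₂ {p : ℝ × ℝ} (hf : ContDiffAt ℝ ω f p) :
    pd₁ (pd₂ (pd₂ f)) p = pd₂ (pd₂ (pd₁ f)) p := by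
  rw [pd₁_pd₂ (contDiffAt_pd₂ hf)]
  exact pd₂_congr ((hf.eventually (by simp)).mono fun q hq => pd₁_pd₂ hq)

theorem eventually_snd {P : ℝ × ℝ → Prop} (h : ∀ᶠ p in 𝓝 (x, y), P p) :
    ∀ᶠ z in 𝓝 y, P (x, z) :=
  (Continuous.prodMk_right x).tendsto y |>.eventually h

theorem iteratedDeriv_two_snd (hf : ContDiffAt ℝ ω f (x, y)) :
    iteratedDeriv 2 (fun z => f (x, z)) y = pd₂ (pd₂ f) (x, y) := by
  rw [iteratedDeriv_succ, iteratedDeriv_one]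
  have h : deriv (fun z => f (x, z)) =ᶠ[𝓝 y] fun z => pd₂ f (x, z) :=
    (eventually_snd (hf.eventually (by simp))).mono fun z hz => (hasDerivAt_snd hz).deriv
  rw [h.deriv_eq]
  exact (hasDerivAt_snd (contDiffAt_pd₂ hf)).deriv

end Partial

/-! ### First order coefficients of powers -/

theorem isHermitian_line {L V : Matrix m m ℂ} (hL : L.IsHermitian) (hV : V.IsHermitian) (ε : ℝ) :
    (L + ε • V).IsHermitian := hL.add (isHermitian_real_smul hV ε)

theorem contDiffAt_line (L V : Matrix m m ℂ) {x : ℝ} {N : WithTop ℕ∞} :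
    ContDiffAt ℝ N (fun ε : ℝ => L + ε • V) x :=
  contDiffAt_const.add (contDiffAt_id.smul contDiffAt_const)

theorem hasDerivAt_line (L V : Matrix m m ℂ) (x : ℝ) :
    HasDerivAt (fun ε : ℝ => L + ε • V) V x := by
  simpa using ((hasDerivAt_id x).smul_const V).const_add L

theorem eventually_line {L : Matrix m m ℂ} {V : Matrix m m ℂ} {P : Matrix m m ℂ → Prop}
    (h : ∀ᶠ A in 𝓝 L, P A) : ∀ᶠ ε : ℝ in 𝓝 0, P (L + ε • V) := by
  have hc := (contDiffAt_line L V (x := 0) (N := 0)).continuousAt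
  rw [ContinuousAt, zero_smul, add_zero] at hc
  exact hc.eventually h

theorem eventually_posDef_line {L V : Matrix m m ℂ} (hL : L.PosDef) (hV : V.IsHermitian) :
    ∀ᶠ ε : ℝ in 𝓝 0, (L + ε • V).PosDef := by
  obtain ⟨g, -, h⟩ := exists_analytic_mlog hL
  exact (eventually_line h).mono fun ε hε => (hε (isHermitian_line hL.1 hV ε)).1

theorem contDiffAt_mlog_line {L V : Matrix m m ℂ} (hL : L.PosDef) (hV : V.IsHermitian) :
    ContDiffAt ℝ ω (fun ε : ℝ => mlog (L + ε • V)) 0 := by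
  obtain ⟨g, hg, h⟩ := exists_analytic_mlog hL
  have h1 : ContDiffAt ℝ ω (fun ε : ℝ => g (L + ε • V)) 0 := by
    refine ContDiffAt.comp (g := g) (0 : ℝ) ?_ (contDiffAt_line L V)
    rwa [zero_smul, add_zero]
  exact h1.congr_of_eventuallyEq
    ((eventually_line h).mono fun ε hε => (hε (isHermitian_line hL.1 hV ε)).2)

/-- The power `(L + ε V) ^ q` as a function of `(q, ε)`, written as an exponential. -/
noncomputable def expLine (L V : Matrix m m ℂ) (p : ℝ × ℝ) : Matrix m m ℂ :=
  NormedSpace.exp (p.1 • mlog (L + p.2 • V))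

theorem contDiffAt_expLine {L V : Matrix m m ℂ} (hL : L.PosDef) (hV : V.IsHermitian) (q : ℝ) :
    ContDiffAt ℝ ω (expLine L V) (q, 0) := by
  refine contDiff_matrixExp.contDiffAt.comp (q, (0 : ℝ)) ?_
  refine contDiffAt_fst.smul ?_
  exact ContDiffAt.comp (g := fun ε : ℝ => mlog (L + ε • V)) (q, (0 : ℝ))
    (contDiffAt_mlog_line hL hV) contDiffAt_snd

theorem eventually_mpow_line {L V : Matrix m m ℂ} (hL : L.PosDef) (hV : V.IsHermitian) (q : ℝ) :
    (fun ε : ℝ => mpow (L + ε • V) q) =ᶠ[𝓝 0] fun ε => expLine L V (q, ε) :=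
  (eventually_posDef_line hL hV).mono fun _ hε => mpow_eq_exp hε q

theorem expLine_zero_right {L : Matrix m m ℂ} (V : Matrix m m ℂ) (hL : L.PosDef) (q : ℝ) :
    expLine L V (q, 0) = mpow L q := by
  rw [expLine, mpow_eq_exp hL]; simp

theorem expLine_add (L V : Matrix m m ℂ) (q r ε : ℝ) :
    expLine L V (q + r, ε) = expLine L V (q, ε) * expLine L V (r, ε) := by
  simp only [expLine, add_smul]
  exact Matrix.exp_add_of_commute _ _ (((Commute.refl _).smul_left q).smul_right r)

theorem hasDerivAt_expLine_fst (L V : Matrix m m ℂ) (q ε : ℝ) :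
    HasDerivAt (fun q => expLine L V (q, ε)) (expLine L V (q, ε) * mlog (L + ε • V)) q :=
  hasDerivAt_exp_smul_const (𝕂 := ℝ) (mlog (L + ε • V)) q

/-- The derivative of `(L + ε V) ^ q` at `ε = 0`. -/
noncomputable def powDeriv (L V : Matrix m m ℂ) (q : ℝ) : Matrix m m ℂ := pd₂ (expLine L V) (q, 0)

section FirstOrder

variable {L V : Matrix m m ℂ} (hL : L.PosDef) (hV : V.IsHermitian)
include hL hV

theorem hasDerivAt_expLine_snd (q : ℝ) :
    HasDerivAt (fun ε => expLine L V (q, ε)) (powDeriv L V q) 0 :=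
  hasDerivAt_snd (contDiffAt_expLine hL hV q)

theorem powDeriv_zero : powDeriv L V 0 = 0 := by
  refine (hasDerivAt_expLine_snd hL hV 0).unique ?_
  simpa [expLine] using hasDerivAt_const (0 : ℝ) (1 : Matrix m m ℂ)

theorem powDeriv_one : powDeriv L V 1 = V := by
  refine (hasDerivAt_expLine_snd hL hV 1).unique ((hasDerivAt_line L V 0).congr_of_eventuallyEq ?_)
  refine (eventually_mpow_line hL hV 1).symm.trans ?_
  exact (eventually_posDef_line hL hV).mono fun ε hε => mpow_one hε

theorem powDeriv_add (q r : ℝ) :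
    powDeriv L V (q + r) = powDeriv L V q * mpow L r + mpow L q * powDeriv L V r := by
  have h := (hasDerivAt_expLine_snd hL hV q).mul (hasDerivAt_expLine_snd hL hV r)
  rw [expLine_zero_right V hL, expLine_zero_right V hL] at h
  refine (hasDerivAt_expLine_snd hL hV (q + r)).unique (h.congr_of_eventuallyEq ?_)
  exact Eventually.of_forall fun ε => expLine_add L V q r ε

/-- By the equality of mixed partial derivatives, the derivative of `(L + ε V) ^ q` in `ε` solves a
linear differential equation in `q`. -/
theorem hasDerivAt_powDeriv (q : ℝ) :
    HasDerivAt (powDeriv L V) (powDeriv L V q * mlog L +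
      mpow L q * deriv (fun ε : ℝ => mlog (L + ε • V)) 0) q := by
  have hc := contDiffAt_expLine hL hV q
  have h := hasDerivAt_fst (contDiffAt_pd₂ hc)
  rw [pd₁_pd₂ hc] at h
  convert! h using 1
  have h1 := hasDerivAt_snd (contDiffAt_pd₁ hc)
  have h2 : (fun ε => pd₁ (expLine L V) (q, ε)) =ᶠ[𝓝 0]
      fun ε => expLine L V (q, ε) * mlog (L + ε • V) :=
    (eventually_snd (hc.eventually (by simp))).mono fun ε hε =>
      (hasDerivAt_fst hε).unique (hasDerivAt_expLine_fst L V q ε)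
  have h3 := (hasDerivAt_expLine_snd hL hV q).mul
    ((contDiffAt_mlog_line hL hV).differentiableAt (by simp)).hasDerivAt
  rw [expLine_zero_right V hL] at h3
  simp only [zero_smul, add_zero] at h3
  exact ((h1.congr_of_eventuallyEq h2.symm).unique h3).symm

/-- Differentiating `(L + ε V) ^ q = ((L + ε V) ^ (q / 2))²` gives the Sylvester equation that defines
`dyadicCoeff`. -/
theorem dyadicCoeff_eq (j : ℕ) : dyadicCoeff L V j = powDeriv L V ((2 ^ j : ℝ)⁻¹) := by
  induction j with
  | zero => simp [dyadicCoeff, powDeriv_one hL hV]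
  | succ j ih =>
    rw [dyadicCoeff, ih, one_div]
    refine sylv_eq_of (posDef_mpow hL _) ?_
    rw [add_comm, ← powDeriv_add hL hV]
    congr 1
    rw [pow_succ]
    field_simp
    norm_num

/-- As `powDeriv L V` vanishes at `0`, the sequence `2 ^ j * dyadicCoeff L V j` consists of difference
quotients at `0`. -/
theorem coeffLimit_eq :
    coeffLimit L V = deriv (fun ε : ℝ => mlog (L + ε • V)) 0 := by
  refine Tendsto.limUnder_eq ?_
  have h := hasDerivAt_powDeriv hL hV 0
  rw [powDeriv_zero hL hV, mpow_zero hL, zero_mul, zero_add, one_mul] at h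
  have h1 := h.tendsto_slope_zero
  have h2 : Tendsto (fun j : ℕ => (2 ^ j : ℝ)⁻¹) atTop (𝓝[≠] 0) := by
    refine tendsto_nhdsWithin_iff.2 ⟨?_, Eventually.of_forall fun j => by simp⟩
    have := tendsto_pow_atTop_nhds_zero_of_lt_one (r := (2⁻¹ : ℝ)) (by norm_num) (by norm_num)
    simpa using this
  have h3 := h1.comp h2
  refine h3.congr fun j => ?_
  simp [dyadicCoeff_eq hL hV, powDeriv_zero hL hV]

/-- Duhamel's formula: variation of constants for the equation of `hasDerivAt_powDeriv`. -/
theorem firstCoeff_eq (q : ℝ) : firstCoeff q L V = powDeriv L V q := by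
  set N := deriv (fun ε : ℝ => mlog (L + ε • V)) 0 with hN
  have hpow : ∀ s, HasDerivAt (fun s => mpow L (-s)) (-(mlog L * mpow L (-s))) s := by
    intro s
    have h := (hasDerivAt_exp_smul_const' (𝕂 := ℝ) (mlog L) (-s)).scomp s (hasDerivAt_neg s)
    simp only [Function.comp_def] at h
    simp only [mpow_eq_exp hL]
    simpa using h
  have hcont : Continuous fun s => mpow L s := by
    simp only [mpow_eq_exp hL]
    exact (contDiff_matrixExp (n := 0)).continuous.comp (by fun_prop)
  -- `L ^ (-s)` is an integrating factor.
  have hd : ∀ s, HasDerivAt (fun s => powDeriv L V s * mpow L (-s))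
      (mpow L s * N * mpow L (-s)) s := by
    intro s
    convert! (hasDerivAt_powDeriv hL hV s).mul (hpow s) using 1
    noncomm_ring
  have hi : ∫ s in (0 : ℝ)..q, mpow L s * N * mpow L (-s) = powDeriv L V q * mpow L (-q) := by
    rw [intervalIntegral.integral_eq_sub_of_hasDerivAt (fun s _ => hd s), powDeriv_zero hL hV,
      zero_mul, sub_zero]
    exact ((hcont.mul continuous_const).mul (hcont.comp continuous_neg)).intervalIntegrable _ _
  have hq : mpow L (-q) * mpow L q = 1 := by rw [← mpow_add hL, neg_add_cancel, mpow_zero hL]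
  rw [firstCoeff, coeffLimit_eq hL hV, ← hN]
  have h1 : ∀ s, mpow L s * N * mpow L (q - s) = mpow L s * N * mpow L (-s) * mpow L q := by
    intro s
    rw [mul_assoc _ (mpow L (-s)), ← mpow_add hL, neg_add_eq_sub]
  simp only [h1]
  have h2 := ((ContinuousLinearMap.mul ℝ (Matrix m m ℂ)).flip (mpow L q)).intervalIntegral_comp_comm
    (f := fun s => mpow L s * N * mpow L (-s)) (μ := volume) (a := 0) (b := q)
    (((hcont.mul continuous_const).mul (hcont.comp continuous_neg)).intervalIntegrable _ _)
  simp only [ContinuousLinearMap.flip_apply, ContinuousLinearMap.mul_apply'] at h2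
  rw [h2, hi, mul_assoc, hq, mul_one]

end FirstOrder

/-! ### Second derivatives of products -/

section Algebra

theorem contDiffAt_deriv {E : Type*} [NormedAddCommGroup E] [NormedSpace ℝ E]
    {f : ℝ → E} {x : ℝ} (hf : ContDiffAt ℝ ω f x) : ContDiffAt ℝ ω (deriv f) x := by
  have := (hf.fderiv_right (m := ω) (by simp)).clm_apply
    (contDiffAt_const (c := (1 : ℝ)) (x := x))
  simpa only [fderiv_apply_one_eq_deriv] using this

theorem hasDerivAt_deriv_of_contDiffAt {E : Type*} [NormedAddCommGroup E] [NormedSpace ℝ E]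
    {f : ℝ → E} {x : ℝ} (hf : ContDiffAt ℝ ω f x) :
    HasDerivAt (deriv f) (iteratedDeriv 2 f x) x := by
  rw [iteratedDeriv_succ, iteratedDeriv_one]
  exact ((contDiffAt_deriv hf).differentiableAt (by simp)).hasDerivAt

theorem iteratedDeriv_two_mul {f g : ℝ → Matrix m m ℂ} {x : ℝ} (hf : ContDiffAt ℝ ω f x)
    (hg : ContDiffAt ℝ ω g x) :
    iteratedDeriv 2 (fun y => f y * g y) x =
      iteratedDeriv 2 f x * g x + (2 : ℝ) • (deriv f x * deriv g x) + f x * iteratedDeriv 2 g x := by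
  have h : deriv (fun y => f y * g y) =ᶠ[𝓝 x] fun y => deriv f y * g y + f y * deriv g y := by
    filter_upwards [hf.eventually (by simp), hg.eventually (by simp)] with y h1 h2
    exact ((h1.differentiableAt (by simp)).hasDerivAt.mul
      (h2.differentiableAt (by simp)).hasDerivAt).deriv
  rw [iteratedDeriv_succ, iteratedDeriv_one, h.deriv_eq]
  have h1 := (hasDerivAt_deriv_of_contDiffAt hf).mul (hg.differentiableAt (by simp)).hasDerivAt
  have h2 := (hf.differentiableAt (by simp)).hasDerivAt.mul (hasDerivAt_deriv_of_contDiffAt hg)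
  refine (h1.add h2).deriv.trans ?_
  rw [two_smul]
  abel

theorem iteratedDeriv_two_line (Q₀ Q' : Matrix m m ℂ) (x : ℝ) :
    iteratedDeriv 2 (fun ε : ℝ => Q₀ + ε • Q') x = 0 := by
  have : deriv (fun ε : ℝ => Q₀ + ε • Q') = fun _ => Q' :=
    funext fun x => (hasDerivAt_line Q₀ Q' x).deriv
  rw [iteratedDeriv_succ, iteratedDeriv_one, this, deriv_const]

theorem isHermitian_of_hasDerivAt {f : ℝ → Matrix m m ℂ} {x : ℝ} {f' : Matrix m m ℂ}
    (hf : HasDerivAt f f' x) (hH : ∀ᶠ y in 𝓝 x, (f y).IsHermitian) : f'.IsHermitian := by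
  have h := hf.star
  exact (h.congr_of_eventuallyEq (hH.mono fun y hy => hy.symm)).unique hf

/-- The second order expansion of a geometric mean: if `G = J P` and `J G` is affine to second
order, then `G''` solves a Sylvester equation whose inhomogeneity is the contribution of `P''` minus
a square. Here `T = J'`. -/
theorem second_order_sylvester {J P G : ℝ → Matrix m m ℂ} {K P₀ G₀ T P' G' : Matrix m m ℂ}
    (hJ : ContDiffAt ℝ ω J 0) (hP : ContDiffAt ℝ ω P 0) (hG : ContDiffAt ℝ ω G 0)
    (hGJP : G =ᶠ[𝓝 0] fun ε => J ε * P ε) {Q₀ Q' : Matrix m m ℂ}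
    (hQ : (fun ε => J ε * G ε) =ᶠ[𝓝 0] fun ε : ℝ => Q₀ + ε • Q')
    (hJ0 : J 0 = K) (hP0 : P 0 = P₀) (hG0 : G 0 = G₀) (hT : HasDerivAt J T 0)
    (hP' : HasDerivAt P P' 0) (hG' : HasDerivAt G G' 0) (hKP : Commute K P₀)
    (hK : K.IsHermitian) (hP'H : P'.IsHermitian) (hG'H : G'.IsHermitian) :
    G' = T * P₀ + K * P' ∧ T * G₀ + K * G' = Q' ∧
    K * iteratedDeriv 2 G 0 + iteratedDeriv 2 G 0 * K
      = K * iteratedDeriv 2 P 0 * K - (2 : ℝ) • (T * (T * P₀)ᴴ) := by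
  have e1 : G' = T * P₀ + K * P' := by
    have h := hT.mul hP'
    rw [hJ0, hP0] at h
    exact hG'.unique (h.congr_of_eventuallyEq hGJP)
  have e2 : T * G₀ + K * G' = Q' := by
    have h := hT.mul hG'
    rw [hJ0, hG0] at h
    exact h.unique ((hasDerivAt_line Q₀ Q' 0).congr_of_eventuallyEq hQ)
  have hGe : G₀ = K * P₀ := by rw [← hG0, hGJP.eq_of_nhds, hJ0, hP0]
  have s1 := (hGJP.iteratedDeriv_eq (n := 2)).trans (iteratedDeriv_two_mul hJ hP)
  have s2 : iteratedDeriv 2 (fun ε => J ε * G ε) 0 = 0 := by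
    rw [hQ.iteratedDeriv_eq, iteratedDeriv_two_line]
  rw [iteratedDeriv_two_mul hJ hG, hT.deriv, hG'.deriv, hJ0, hG0] at s2
  rw [hT.deriv, hP'.deriv, hJ0, hP0] at s1
  refine ⟨e1, e2, ?_⟩
  set J2 := iteratedDeriv 2 J 0
  set P2 := iteratedDeriv 2 P 0
  set G2 := iteratedDeriv 2 G 0
  have hY : (T * P₀)ᴴ = G' - P' * K := by
    have : T * P₀ = G' - K * P' := by rw [e1]; abel
    rw [this, Matrix.conjTranspose_sub, Matrix.conjTranspose_mul, hK.eq, hP'H.eq, hG'H.eq]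
  have h1 : J2 * G₀ = (G2 - (2 : ℝ) • (T * P') - K * P2) * K := by
    rw [hGe, hKP.eq, s1]
    noncomm_ring
  rw [h1] at s2
  rw [hY, ← sub_eq_zero, ← s2]
  simp only [two_smul, mul_sub, sub_mul, add_mul]
  noncomm_ring

end Algebra

/-! ### Kronecker products -/

section Kron

variable {n : Type*} [Fintype n] [DecidableEq n]

/-- `A ↦ A ⊗ I` as a continuous linear map. -/
noncomputable def kronOne : Matrix n n ℂ →L[ℝ] Matrix (n × n) (n × n) ℂ :=
  LinearMap.toContinuousLinearMap
    { toFun := fun A => A ⊗ₖ (1 : Matrix n n ℂ)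
      map_add' := fun A B => Matrix.add_kronecker A B 1
      map_smul' := fun r A => Matrix.smul_kronecker r A 1 }

/-- `B ↦ I ⊗ B` as a continuous linear map. -/
noncomputable def oneKron : Matrix n n ℂ →L[ℝ] Matrix (n × n) (n × n) ℂ :=
  LinearMap.toContinuousLinearMap
    { toFun := fun B => (1 : Matrix n n ℂ) ⊗ₖ B
      map_add' := fun A B => Matrix.kronecker_add 1 A B
      map_smul' := fun r A => Matrix.kronecker_smul r 1 A }

theorem kronOne_apply (A : Matrix n n ℂ) : kronOne A = A ⊗ₖ (1 : Matrix n n ℂ) := rfl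

theorem oneKron_apply (B : Matrix n n ℂ) : oneKron B = (1 : Matrix n n ℂ) ⊗ₖ B := rfl

theorem kronOne_mul_oneKron (A B : Matrix n n ℂ) : kronOne A * oneKron B = A ⊗ₖ B := by
  rw [kronOne_apply, oneKron_apply, ← Matrix.mul_kronecker_mul, mul_one, one_mul]

theorem contDiffAt_kronecker {E : Type*} [NormedAddCommGroup E] [NormedSpace ℝ E] {N : WithTop ℕ∞}
    {f g : E → Matrix n n ℂ} {x : E} (hf : ContDiffAt ℝ N f x) (hg : ContDiffAt ℝ N g x) :
    ContDiffAt ℝ N (fun y => f y ⊗ₖ g y) x := by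
  have h1 : ContDiffAt ℝ N (fun y => kronOne (f y)) x :=
    ContDiffAt.comp x (kronOne (n := n)).contDiff.contDiffAt hf
  have h2 : ContDiffAt ℝ N (fun y => oneKron (g y)) x :=
    ContDiffAt.comp x (oneKron (n := n)).contDiff.contDiffAt hg
  have h := h1.mul h2
  simp only [kronOne_mul_oneKron] at h
  exact h

theorem hasDerivAt_kronecker {f g : ℝ → Matrix n n ℂ} {f' g' : Matrix n n ℂ} {x : ℝ}
    (hf : HasDerivAt f f' x) (hg : HasDerivAt g g' x) :
    HasDerivAt (fun y => f y ⊗ₖ g y) (f' ⊗ₖ g x + f x ⊗ₖ g') x := by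
  have h1 : HasDerivAt (fun y => kronOne (f y)) (kronOne f') x :=
    HasFDerivAt.comp_hasDerivAt x (kronOne (n := n)).hasFDerivAt hf
  have h2 : HasDerivAt (fun y => oneKron (g y)) (oneKron g') x :=
    HasFDerivAt.comp_hasDerivAt x (oneKron (n := n)).hasFDerivAt hg
  have h := h1.mul h2
  simp only [kronOne_mul_oneKron, Pi.mul_def] at h
  exact h

theorem isHermitian_kronecker {A B : Matrix n n ℂ} (hA : A.IsHermitian) (hB : B.IsHermitian) :
    (A ⊗ₖ B).IsHermitian := by
  rw [Matrix.IsHermitian, Matrix.conjTranspose_kronecker, hA.eq, hB.eq]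

theorem rdiag_kronecker (k l : n → ℝ) :
    rdiag k ⊗ₖ rdiag l = rdiag fun p : n × n => k p.1 * l p.2 := by
  simp only [rdiag, Matrix.diagonal_kronecker_diagonal]
  congr 1
  ext p
  simp

/-- Matrices `Ψ ^ a ⊗ Φ ^ b` are diagonal in a common orthonormal basis. -/
theorem exists_aut_kronecker {Ψ Φ : Matrix n n ℂ} (hΨ : Ψ.PosDef) (hΦ : Φ.PosDef) :
    ∃ (U : unitary (Matrix (n × n) (n × n) ℂ)) (k l : n → ℝ), (∀ i, 0 < k i) ∧ (∀ i, 0 < l i) ∧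
      ∀ a b : ℝ, mpow Ψ a ⊗ₖ mpow Φ b
        = Unitary.conjStarAlgAut ℂ _ U (rdiag fun p : n × n => k p.1 ^ a * l p.2 ^ b) := by
  obtain ⟨U, k, hk, hΨU⟩ := exists_aut_rdiag hΨ
  obtain ⟨W, l, hl, hΦW⟩ := exists_aut_rdiag hΦ
  refine ⟨⟨(U : Matrix n n ℂ) ⊗ₖ (W : Matrix n n ℂ), Matrix.kronecker_mem_unitary U.2 W.2⟩, k, l,
    hk, hl, fun a b => ?_⟩
  have h : (rdiag fun p : n × n => k p.1 ^ a * l p.2 ^ b)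
      = (rdiag fun i => k i ^ a) ⊗ₖ (rdiag fun i => l i ^ b) :=
    (rdiag_kronecker (fun i => k i ^ a) (fun i => l i ^ b)).symm
  rw [hΨU, hΦW, ← aut_mpow _ (isHermitian_rdiag _), ← aut_mpow _ (isHermitian_rdiag _),
    mpow_rdiag hk, mpow_rdiag hl, h]
  simp only [Unitary.conjStarAlgAut_apply, Matrix.mul_kronecker_mul,
    Matrix.star_eq_conjTranspose, Matrix.conjTranspose_kronecker]

theorem posDef_mpow_kronecker {Ψ Φ : Matrix n n ℂ} (hΨ : Ψ.PosDef) (hΦ : Φ.PosDef) (a b : ℝ) :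
    (mpow Ψ a ⊗ₖ mpow Φ b).PosDef :=
  (posDef_mpow hΨ a).kronecker (posDef_mpow hΦ b)

theorem mpow_kronecker_mul {Ψ Φ : Matrix n n ℂ} (hΨ : Ψ.PosDef) (hΦ : Φ.PosDef) (a b c d : ℝ) :
    (mpow Ψ a ⊗ₖ mpow Φ b) * (mpow Ψ c ⊗ₖ mpow Φ d) = mpow Ψ (a + c) ⊗ₖ mpow Φ (b + d) := by
  rw [← Matrix.mul_kronecker_mul, mpow_add hΨ, mpow_add hΦ]

end Kron

/-! ### The second derivative of `F_k` -/

section Recursion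

variable {n : Type*} [Fintype n] [DecidableEq n] {Ψ Φ V W : Matrix n n ℂ}

/-- `(Ψ + ε V) ^ a ⊗ (Φ + ε W) ^ b` as a function of `ε`, written with exponentials. -/
noncomputable def kronLine (Ψ Φ V W : Matrix n n ℂ) (a b ε : ℝ) : Matrix (n × n) (n × n) ℂ :=
  expLine Ψ V (a, ε) ⊗ₖ expLine Φ W (b, ε)

theorem dlt_pos (k : ℕ) : 0 < dlt k := by rw [dlt]; positivity

theorem dlt_succ (k : ℕ) : dlt k = dlt (k + 1) + dlt (k + 1) := by
  simp only [dlt, pow_succ]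
  field_simp
  norm_num

theorem GammaK_zero : GammaK Ψ Φ V W 0 = 0 := by simp [GammaK]

theorem Dop_sum (hΨ : Ψ.PosDef) (hΦ : Φ.PosDef) (δ : ℝ) (s : Finset ℕ)
    (f : ℕ → Matrix (n × n) (n × n) ℂ) :
    Dop Ψ Φ δ (∑ i ∈ s, f i) = ∑ i ∈ s, Dop Ψ Φ δ (f i) := by
  have hK : (Kdelta Ψ Φ δ).PosDef := posDef_mpow_kronecker hΨ hΦ _ _
  classical
  induction s using Finset.induction_on with
  | empty => simpa [Dop] using sylv_zero hK
  | insert a s ha ih =>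
    rw [Finset.sum_insert ha, Finset.sum_insert ha, ← ih]
    exact sylv_add hK _ _

theorem GammaK_succ (hΨ : Ψ.PosDef) (hΦ : Φ.PosDef) (k : ℕ) :
    GammaK Ψ Φ V W (k + 1) =
      Source Ψ Φ V W (k + 1) + Dop Ψ Φ (-dlt (k + 1)) (GammaK Ψ Φ V W k) := by
  rw [GammaK, Finset.sum_Icc_succ_top (by omega), add_comm, Nat.sub_self, GammaK, Dop_sum hΨ hΦ]
  congr 1
  refine Finset.sum_congr rfl fun l hl => ?_
  have hl := (Finset.mem_Icc.1 hl).2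
  rw [Nat.sub_add_comm hl, iterD, ← add_assoc, Nat.add_sub_of_le hl]

variable (hΨ : Ψ.PosDef) (hΦ : Φ.PosDef) (hV : V.IsHermitian) (hW : W.IsHermitian)
include hΨ hΦ hV hW

theorem contDiffAt_kronLine (a b : ℝ) : ContDiffAt ℝ ω (kronLine Ψ Φ V W a b) 0 := by
  refine contDiffAt_kronecker ?_ ?_
  · exact (contDiffAt_expLine hΨ hV a).comp (0 : ℝ) (contDiffAt_const.prodMk contDiffAt_id)
  · exact (contDiffAt_expLine hΦ hW b).comp (0 : ℝ) (contDiffAt_const.prodMk contDiffAt_id)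

theorem eventually_Fk_line (k : ℕ) :
    (fun ε : ℝ => Fk k (Ψ + ε • V) (Φ + ε • W)) =ᶠ[𝓝 0]
      kronLine Ψ Φ V W (1 - dlt k) (dlt k) := by
  filter_upwards [eventually_mpow_line hΨ hV (1 - dlt k), eventually_mpow_line hΦ hW (dlt k)]
    with ε h1 h2
  simp only [Fk, kronLine, h1, h2]

theorem hasDerivAt_kronLine (a b : ℝ) :
    HasDerivAt (kronLine Ψ Φ V W a b)
      (firstCoeff a Ψ V ⊗ₖ mpow Φ b + mpow Ψ a ⊗ₖ firstCoeff b Φ W) 0 := by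
  have h := hasDerivAt_kronecker (hasDerivAt_expLine_snd hΨ hV a) (hasDerivAt_expLine_snd hΦ hW b)
  rwa [expLine_zero_right V hΨ, expLine_zero_right W hΦ, ← firstCoeff_eq hΨ hV,
    ← firstCoeff_eq hΦ hW] at h

omit hV hW in
theorem kronLine_zero_right (a b : ℝ) : kronLine Ψ Φ V W a b 0 = mpow Ψ a ⊗ₖ mpow Φ b := by
  rw [kronLine, expLine_zero_right V hΨ, expLine_zero_right W hΦ]

omit hΨ hΦ hV hW in
theorem kronLine_mul (a b c d ε : ℝ) :
    kronLine Ψ Φ V W a b ε * kronLine Ψ Φ V W c d ε = kronLine Ψ Φ V W (a + c) (b + d) ε := by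
  simp only [kronLine, expLine_add, Matrix.mul_kronecker_mul]

omit hΨ hΦ hV hW in
theorem isHermitian_kronLine (a b ε : ℝ) : (kronLine Ψ Φ V W a b ε).IsHermitian :=
  isHermitian_kronecker (isHermitian_real_smul (isHermitian_mlog _) _).exp
    (isHermitian_real_smul (isHermitian_mlog _) _).exp

theorem eventually_kronLine_one_zero :
    kronLine Ψ Φ V W 1 0 =ᶠ[𝓝 0] fun ε : ℝ =>
      Ψ ⊗ₖ (1 : Matrix n n ℂ) + ε • (V ⊗ₖ (1 : Matrix n n ℂ)) := by
  filter_upwards [eventually_posDef_line hΨ hV] with ε h1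
  rw [kronLine, expLine, expLine, one_smul, zero_smul, NormedSpace.exp_zero, exp_mlog h1,
    Matrix.add_kronecker, Matrix.smul_kronecker]

/-- With `K = Ψ ^ δ ⊗ Φ ^ (-δ)` and `δ = 2^{-(k+1)}`, both `Source` and the second derivative of
`F_{k+1}` satisfy a Sylvester equation for `K` with the same square `T (T P)ᴴ`. -/
theorem exists_sylvester_equations (k : ℕ) :
    ∃ T : Matrix (n × n) (n × n) ℂ,
      Kdelta Ψ Φ (dlt (k + 1)) * Source Ψ Φ V W (k + 1)
          + Source Ψ Φ V W (k + 1) * Kdelta Ψ Φ (dlt (k + 1))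
        = T * (T * (mpow Ψ (1 - dlt k) ⊗ₖ mpow Φ (dlt k)))ᴴ ∧
      Kdelta Ψ Φ (dlt (k + 1)) *
          iteratedDeriv 2 (kronLine Ψ Φ V W (1 - dlt (k + 1)) (dlt (k + 1))) 0
        + iteratedDeriv 2 (kronLine Ψ Φ V W (1 - dlt (k + 1)) (dlt (k + 1))) 0
          * Kdelta Ψ Φ (dlt (k + 1))
        = Kdelta Ψ Φ (dlt (k + 1)) * iteratedDeriv 2 (kronLine Ψ Φ V W (1 - dlt k) (dlt k)) 0
            * Kdelta Ψ Φ (dlt (k + 1))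
          - (2 : ℝ) • (T * (T * (mpow Ψ (1 - dlt k) ⊗ₖ mpow Φ (dlt k)))ᴴ) := by
  set δ := dlt (k + 1) with hδ
  have hk : dlt k = δ + δ := dlt_succ k
  set T : Matrix (n × n) (n × n) ℂ := firstCoeff δ Ψ V ⊗ₖ mpow Φ (-δ) + mpow Ψ δ ⊗ₖ firstCoeff (-δ) Φ W with hTdef
  have hT := hasDerivAt_kronLine hΨ hΦ hV hW δ (-δ)
  have hP' := hasDerivAt_kronLine hΨ hΦ hV hW (1 - dlt k) (dlt k)
  have hG' := hasDerivAt_kronLine hΨ hΦ hV hW (1 - δ) δ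
  have hH : ∀ a b : ℝ, ∀ᶠ ε in 𝓝 (0 : ℝ), (kronLine Ψ Φ V W a b ε).IsHermitian := fun a b =>
    Eventually.of_forall (isHermitian_kronLine a b)
  have hcomm : Commute (mpow Ψ δ ⊗ₖ mpow Φ (-δ)) (mpow Ψ (1 - dlt k) ⊗ₖ mpow Φ (dlt k)) := by
    rw [Commute, SemiconjBy, mpow_kronecker_mul hΨ hΦ, mpow_kronecker_mul hΨ hΦ, add_comm δ,
      add_comm (-δ)]
  have hGJP : kronLine Ψ Φ V W (1 - δ) δ =ᶠ[𝓝 0] fun ε =>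
      kronLine Ψ Φ V W δ (-δ) ε * kronLine Ψ Φ V W (1 - dlt k) (dlt k) ε := by
    refine Eventually.of_forall fun ε => ?_
    simp only [kronLine_mul, hk]
    ring_nf
  have hQ : (fun ε => kronLine Ψ Φ V W δ (-δ) ε * kronLine Ψ Φ V W (1 - δ) δ ε) =ᶠ[𝓝 0]
      fun ε : ℝ => Ψ ⊗ₖ (1 : Matrix n n ℂ) + ε • (V ⊗ₖ (1 : Matrix n n ℂ)) := by
    refine EventuallyEq.trans (Eventually.of_forall fun ε => ?_)
      (eventually_kronLine_one_zero hΨ hΦ hV hW)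
    simp only [kronLine_mul]
    ring_nf
  obtain ⟨e1, e2, e3⟩ := second_order_sylvester (contDiffAt_kronLine hΨ hΦ hV hW δ (-δ))
    (contDiffAt_kronLine hΨ hΦ hV hW (1 - dlt k) (dlt k))
    (contDiffAt_kronLine hΨ hΦ hV hW (1 - δ) δ)
    hGJP hQ
    (kronLine_zero_right hΨ hΦ _ _) (kronLine_zero_right hΨ hΦ _ _) (kronLine_zero_right hΨ hΦ _ _)
    hT hP' hG' hcomm (posDef_mpow_kronecker hΨ hΦ _ _).1 (isHermitian_of_hasDerivAt hP' (hH _ _))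
    (isHermitian_of_hasDerivAt hG' (hH _ _))
  refine ⟨T, ?_, e3⟩
  obtain ⟨U, x, y, hx, hy, hU⟩ := exists_aut_kronecker hΨ hΦ
  have hpos : ∀ a b : ℝ, ∀ p : n × n, 0 < x p.1 ^ a * y p.2 ^ b := fun a b p =>
    mul_pos (Real.rpow_pos_of_pos (hx _) _) (Real.rpow_pos_of_pos (hy _) _)
  -- `Cross` is applied to `A = P`, `B = P K² = Ψ ⊗ I`, with `Y = T P = G' - K P'`.
  refine Cross_sylvester (hpos _ _) (hpos _ _) (hU (1 - dlt k) (dlt k)) (hU δ (-δ)) ?_ ?_ rfl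
  · simp only [Nat.add_sub_cancel, Kdelta]
    rw [mpow_kronecker_mul hΨ hΦ, mpow_kronecker_mul hΨ hΦ, hk]
    have h1 : 1 - (δ + δ) + δ + δ = 1 := by ring
    have h2 : δ + δ + -δ + -δ = 0 := by ring
    rw [h1, h2, mpow_one hΨ, mpow_zero hΦ]
  · have hG0 : mpow Ψ (1 - δ) ⊗ₖ mpow Φ δ
        = (mpow Ψ (1 - dlt k) ⊗ₖ mpow Φ (dlt k)) * (mpow Ψ δ ⊗ₖ mpow Φ (-δ)) := by
      rw [mpow_kronecker_mul hΨ hΦ, hk]; ring_nf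
    simp only [Nat.add_sub_cancel]
    rw [← hTdef] at e1 e2
    rw [← e2, e1, hG0, Kdelta]
    simp only [mul_add, mul_assoc]
    abel

/-- The second derivative of `F_k` along a line is `-2 Γ_k`. -/
theorem iteratedDeriv_two_kronLine (k : ℕ) :
    iteratedDeriv 2 (kronLine Ψ Φ V W (1 - dlt k) (dlt k)) 0 = (-2 : ℝ) • GammaK Ψ Φ V W k := by
  induction k with
  | zero =>
    have h : kronLine Ψ Φ V W (1 - dlt 0) (dlt 0) =ᶠ[𝓝 0] fun ε : ℝ =>
        (1 : Matrix n n ℂ) ⊗ₖ Φ + ε • ((1 : Matrix n n ℂ) ⊗ₖ W) := by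
      filter_upwards [eventually_posDef_line hΦ hW] with ε h1
      simp [kronLine, expLine, dlt, exp_mlog h1, Matrix.kronecker_add, Matrix.kronecker_smul]
    rw [h.iteratedDeriv_eq, GammaK_zero, smul_zero, iteratedDeriv_two_line]
  | succ k ih =>
    obtain ⟨T, hS, hG⟩ := exists_sylvester_equations hΨ hΦ hV hW k
    rw [ih] at hG
    set δ := dlt (k + 1)
    set K := Kdelta Ψ Φ δ with hKdef
    have hK : K.PosDef := posDef_mpow_kronecker hΨ hΦ _ _
    have hD := sylv_spec (K := Kdelta Ψ Φ (-δ)) (posDef_mpow_kronecker hΨ hΦ _ _)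
      (GammaK Ψ Φ V W k)
    have hKK : K * Kdelta Ψ Φ (-δ) = 1 := by
      rw [hKdef, Kdelta, Kdelta, mpow_kronecker_mul hΨ hΦ, add_neg_cancel, add_neg_cancel,
        mpow_zero hΨ, mpow_zero hΦ, Matrix.one_kronecker_one]
    have hKK' : Kdelta Ψ Φ (-δ) * K = 1 := by
      rw [hKdef, Kdelta, Kdelta, mpow_kronecker_mul hΨ hΦ, neg_add_cancel, neg_add_cancel,
        mpow_zero hΨ, mpow_zero hΦ, Matrix.one_kronecker_one]
    rw [← sub_eq_zero]
    refine eq_zero_of_sylvester hK ?_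
    rw [GammaK_succ hΨ hΦ, Dop]
    set D := sylv (Kdelta Ψ Φ (-δ)) (GammaK Ψ Φ V W k)
    set S := Source Ψ Φ V W (k + 1)
    -- Multiplying the Sylvester equation for `K⁻¹` by `K` on both sides gives one for `K`.
    have hD2 : K * GammaK Ψ Φ V W k * K = D * K + K * D := by
      rw [← hD, mul_add, add_mul, ← mul_assoc, ← mul_assoc, hKK, one_mul, mul_assoc _ _ K, hKK',
        mul_one]
    have h1 : ∀ G : Matrix (n × n) (n × n) ℂ,
        K * (G - (-2 : ℝ) • (S + D)) + (G - (-2 : ℝ) • (S + D)) * K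
        = (K * G + G * K) + (2 : ℝ) • (K * S + S * K) + (2 : ℝ) • (D * K + K * D) := by
      intro G
      simp only [mul_sub, sub_mul, mul_add, add_mul, smul_add, mul_smul_comm, smul_mul_assoc,
        neg_smul, mul_neg, neg_mul]
      abel
    rw [h1, hG, hS, ← hD2, mul_smul_comm, smul_mul_assoc]
    simp only [neg_smul]
    abel

/-- `Source` is the solution of a Sylvester equation with right-hand side `T P Tᴴ ≥ 0`. -/
theorem posSemidef_Source (k : ℕ) : (Source Ψ Φ V W (k + 1)).PosSemidef := by
  obtain ⟨T, hS, -⟩ := exists_sylvester_equations hΨ hΦ hV hW k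
  have hK : (Kdelta Ψ Φ (dlt (k + 1))).PosDef := posDef_mpow_kronecker hΨ hΦ _ _
  have hP := posDef_mpow_kronecker hΨ hΦ (1 - dlt k) (dlt k)
  rw [← sylv_eq_of hK hS, Matrix.conjTranspose_mul, hP.1.eq, ← mul_assoc]
  exact posSemidef_sylv hK.1 (hP.posSemidef.mul_mul_conjTranspose_same T)

theorem posSemidef_GammaK (k : ℕ) : (GammaK Ψ Φ V W k).PosSemidef := by
  induction k with
  | zero => rw [GammaK_zero]; exact Matrix.PosSemidef.zero
  | succ k ih =>
    rw [GammaK_succ hΨ hΦ]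
    exact (posSemidef_Source hΨ hΦ hV hW k).add
      (posSemidef_sylv (posDef_mpow_kronecker hΨ hΦ _ _).1 ih)

end Recursion

/-! ### The limit of `2 ^ k Γ_k` -/

section Limit

variable {n : Type*} [Fintype n] [DecidableEq n] {Ψ Φ V W : Matrix n n ℂ}

/-- `(Ψ + ε V) ^ (1 - δ) ⊗ (Φ + ε W) ^ δ` as a function of `(δ, ε)`. -/
noncomputable def powLine (Ψ Φ V W : Matrix n n ℂ) (p : ℝ × ℝ) : Matrix (n × n) (n × n) ℂ :=
  kronLine Ψ Φ V W (1 - p.1) p.1 p.2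

/-- `Flog` along a line. -/
noncomputable def flogLine (Ψ Φ V W : Matrix n n ℂ) (ε : ℝ) : Matrix (n × n) (n × n) ℂ :=
  Flog (Ψ + ε • V) (Φ + ε • W)

/-- The limit `Γ` of `2 ^ k Γ_k`, given as the second derivative of `Flog` along the line, up to the
factor `2 log₂ e = 2 / log 2`. -/
noncomputable def gammaLim (Ψ Φ V W : Matrix n n ℂ) : Matrix (n × n) (n × n) ℂ :=
  (Real.log 2 / 2) • iteratedDeriv 2 (flogLine Ψ Φ V W) 0

/-- A constant for the rate of convergence of `2 ^ k Γ_k`, chosen as a function of `Ψ, Φ, V, W`; one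
exists by `exists_rate`. -/
noncomputable def rateConst (Ψ Φ V W : Matrix n n ℂ) : ℝ :=
  Classical.epsilon fun C : ℝ => ∀ k : ℕ,
    ‖(2 ^ k : ℝ) • GammaK Ψ Φ V W k - gammaLim Ψ Φ V W‖ ≤ C * (2 ^ k)⁻¹

variable (hΨ : Ψ.PosDef) (hΦ : Φ.PosDef) (hV : V.IsHermitian) (hW : W.IsHermitian)
include hΨ hΦ hV hW

theorem contDiffAt_powLine (δ : ℝ) : ContDiffAt ℝ ω (powLine Ψ Φ V W) (δ, 0) := by
  refine contDiffAt_kronecker ?_ (contDiffAt_expLine hΦ hW δ)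
  exact ContDiffAt.comp (g := expLine Ψ V) (δ, (0 : ℝ)) (contDiffAt_expLine hΨ hV (1 - δ))
    ((contDiffAt_const.sub contDiffAt_fst).prodMk contDiffAt_snd)

theorem contDiffAt_flogLine : ContDiffAt ℝ ω (flogLine Ψ Φ V W) 0 := by
  have h1 : flogLine Ψ Φ V W = fun ε : ℝ =>
      ((Ψ + ε • V) * ((Real.log 2)⁻¹ • mlog (Ψ + ε • V))) ⊗ₖ (1 : Matrix n n ℂ)
        - (Ψ + ε • V) ⊗ₖ ((Real.log 2)⁻¹ • mlog (Φ + ε • W)) := by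
    ext1 ε
    rw [flogLine, Flog, mlog2_eq, mlog2_eq]
  rw [h1]
  refine ContDiffAt.sub ?_ ?_
  · exact contDiffAt_kronecker ((contDiffAt_line Ψ V).mul
      ((contDiffAt_mlog_line hΨ hV).const_smul _)) contDiffAt_const
  · exact contDiffAt_kronecker (contDiffAt_line Ψ V) ((contDiffAt_mlog_line hΦ hW).const_smul _)

/-- The derivative of `powLine` in `δ` at `δ = 0` is a multiple of `Flog`. -/
theorem eventually_pd₁_powLine :
    (fun ε => pd₁ (powLine Ψ Φ V W) (0, ε)) =ᶠ[𝓝 0]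
      fun ε => (-Real.log 2) • flogLine Ψ Φ V W ε := by
  filter_upwards [eventually_posDef_line hΨ hV, eventually_posDef_line hΦ hW,
    eventually_snd ((contDiffAt_powLine hΨ hΦ hV hW 0).eventually (by simp))] with ε h1 h2 h3
  have hA : HasDerivAt (fun δ => expLine Ψ V (1 - δ, ε))
      (-((Ψ + ε • V) * mlog (Ψ + ε • V))) 0 := by
    have h := (hasDerivAt_expLine_fst Ψ V (1 - 0) ε).scomp (0 : ℝ)
      ((hasDerivAt_id (0 : ℝ)).const_sub 1)
    simpa [Function.comp_def, expLine, exp_mlog h1] using h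
  have hB : HasDerivAt (fun δ => expLine Φ W (δ, ε)) (mlog (Φ + ε • W)) 0 := by
    simpa [expLine] using hasDerivAt_expLine_fst Φ W 0 ε
  have h := hasDerivAt_kronecker hA hB
  refine ((hasDerivAt_fst h3).unique h).trans ?_
  have hlog : Real.log 2 ≠ 0 := (Real.log_pos (by norm_num)).ne'
  have e1 : expLine Ψ V (1 - 0, ε) = Ψ + ε • V := by simp [expLine, exp_mlog h1]
  have e2 : expLine Φ W (0, ε) = 1 := by simp [expLine]
  have hm : ∀ A : Matrix n n ℂ, mlog A = Real.log 2 • mlog2 A := fun A => by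
    rw [mlog2_eq, smul_smul, mul_inv_cancel₀ hlog, one_smul]
  rw [e1, e2, flogLine, Flog, hm, hm, mul_smul_comm, ← smul_neg, Matrix.smul_kronecker,
    Matrix.kronecker_smul, ← neg_one_smul ℝ ((Ψ + ε • V) * _), Matrix.smul_kronecker]
  module

/-- The second derivative in `ε` at `ε = 0` of `(Ψ + ε V) ^ (1 - δ) ⊗ (Φ + ε W) ^ δ` vanishes at
`δ = 0`, where the function is affine in `ε`, and its derivative in `δ` is `-2 Γ`. -/
theorem hasDerivAt_second_zero :
    pd₂ (pd₂ (powLine Ψ Φ V W)) (0, 0) = 0 ∧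
    HasDerivAt (fun δ => pd₂ (pd₂ (powLine Ψ Φ V W)) (δ, 0))
      ((-2 : ℝ) • gammaLim Ψ Φ V W) 0 := by
  have hc := contDiffAt_powLine hΨ hΦ hV hW 0
  constructor
  · rw [← iteratedDeriv_two_snd hc]
    simp only [powLine, sub_zero]
    rw [(eventually_kronLine_one_zero hΨ hΦ hV hW).iteratedDeriv_eq, iteratedDeriv_two_line]
  · have h := hasDerivAt_fst (contDiffAt_pd₂ (contDiffAt_pd₂ hc))
    rw [pd₁_pd₂_pd₂ hc, ← iteratedDeriv_two_snd (contDiffAt_pd₁ hc),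
      (eventually_pd₁_powLine hΨ hΦ hV hW).iteratedDeriv_eq,
      iteratedDeriv_fun_const_smul_field] at h
    convert! h using 1
    rw [gammaLim, smul_smul]
    congr 1
    ring

/-- Taylor's formula at `δ = 0` for the second derivative in `ε`, evaluated at `δ = 2 ^ (-k)`. -/
theorem exists_rate : ∃ C : ℝ, ∀ k : ℕ,
    ‖(2 ^ k : ℝ) • GammaK Ψ Φ V W k - gammaLim Ψ Φ V W‖ ≤ C * (2 ^ k)⁻¹ := by
  set H : ℝ → Matrix (n × n) (n × n) ℂ := fun δ => pd₂ (pd₂ (powLine Ψ Φ V W)) (δ, 0) with hH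
  obtain ⟨h0, h1⟩ := hasDerivAt_second_zero hΨ hΦ hV hW
  have hsm : ContDiffOn ℝ (1 + 1 : ℕ) H (Icc 0 1) := fun δ _ => by
    have h : ContDiffAt ℝ ω H δ :=
      ContDiffAt.comp (g := pd₂ (pd₂ (powLine Ψ Φ V W))) δ
        (contDiffAt_pd₂ (contDiffAt_pd₂ (contDiffAt_powLine hΨ hΦ hV hW δ)))
        (contDiffAt_id.prodMk contDiffAt_const)
    exact (h.of_le (by simp)).contDiffWithinAt
  obtain ⟨C, hC⟩ := exists_taylor_mean_remainder_bound (n := 1) zero_le_one (by exact_mod_cast hsm)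
  have hT : ∀ δ, taylorWithinEval H 1 (Icc 0 1) 0 δ = δ • ((-2 : ℝ) • gammaLim Ψ Φ V W) := by
    intro δ
    have hd : derivWithin H (Icc 0 1) 0 = (-2 : ℝ) • gammaLim Ψ Φ V W :=
      h1.hasDerivWithinAt.derivWithin (uniqueDiffOn_Icc one_pos 0 (by simp))
    rw [taylorWithinEval_succ, taylor_within_zero_eval, zero_add, iteratedDerivWithin_one, hd]
    have : H 0 = 0 := h0
    simp [this]
  refine ⟨C / 2, fun k => ?_⟩
  have hk : (0 : ℝ) < 2 ^ k := by positivity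
  have hmem : dlt k ∈ Icc (0 : ℝ) 1 :=
    ⟨(dlt_pos k).le, inv_le_one_of_one_le₀ (one_le_pow₀ (by norm_num))⟩
  have hHk : H (dlt k) = (-2 : ℝ) • GammaK Ψ Φ V W k := by
    rw [← iteratedDeriv_two_kronLine hΨ hΦ hV hW]
    exact (iteratedDeriv_two_snd (contDiffAt_powLine hΨ hΦ hV hW (dlt k))).symm
  have hb := hC _ hmem
  rw [hT, hHk, sub_zero] at hb
  have he : (2 ^ k : ℝ) • GammaK Ψ Φ V W k - gammaLim Ψ Φ V W
      = (-(2 ^ k / 2) : ℝ) • ((-2 : ℝ) • GammaK Ψ Φ V W k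
        - dlt k • (-2 : ℝ) • gammaLim Ψ Φ V W) := by
    rw [smul_sub, smul_smul, smul_smul, smul_smul, dlt]
    congr 1
    · congr 1; ring
    · nth_rw 1 [← one_smul ℝ (gammaLim Ψ Φ V W)]
      congr 1
      field_simp
  rw [he, norm_smul, norm_neg, Real.norm_of_nonneg (by positivity)]
  calc (2 ^ k / 2 : ℝ) * _ ≤ 2 ^ k / 2 * (C * dlt k ^ (1 + 1)) := by gcongr
    _ = C / 2 * (2 ^ k)⁻¹ := by rw [dlt, one_add_one_eq_two]; field_simp

theorem rateConst_spec (k : ℕ) :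
    ‖(2 ^ k : ℝ) • GammaK Ψ Φ V W k - gammaLim Ψ Φ V W‖ ≤ rateConst Ψ Φ V W * (2 ^ k)⁻¹ :=
  Classical.epsilon_spec (exists_rate hΨ hΦ hV hW) k

theorem posSemidef_gammaLim : (gammaLim Ψ Φ V W).PosSemidef := by
  obtain ⟨C, hC⟩ := exists_rate hΨ hΦ hV hW
  have ht : Tendsto (fun k : ℕ => (2 ^ k : ℝ) • GammaK Ψ Φ V W k) atTop
      (𝓝 (gammaLim Ψ Φ V W)) := by
    rw [tendsto_iff_norm_sub_tendsto_zero]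
    refine squeeze_zero (fun _ => norm_nonneg _) hC ?_
    have := tendsto_pow_atTop_nhds_zero_of_lt_one (r := (2⁻¹ : ℝ)) (by norm_num) (by norm_num)
    simpa using this.const_mul C
  rw [← Matrix.nonneg_iff_posSemidef]
  refine ge_of_tendsto' ht fun k => ?_
  exact smul_nonneg (by positivity)
    (Matrix.nonneg_iff_posSemidef.2 (posSemidef_GammaK hΨ hΦ hV hW k))

end Limit

/-! ### Relative entropy along a segment -/

section Entropy

variable {n : Type*} [Fintype n] [DecidableEq n]

theorem posDef_path {A₁ A₂ : Matrix n n ℂ} (h₁ : A₁.PosDef) (h₂ : A₂.PosDef) {t : ℝ}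
    (ht : t ∈ Icc (0 : ℝ) 1) : (path A₁ A₂ t).PosDef := by
  rcases eq_or_lt_of_le ht.1 with rfl | h0
  · simpa [path] using h₂
  · exact (h₁.smul h0).add_posSemidef (h₂.posSemidef.smul (sub_nonneg.2 ht.2))

theorem path_eq_line (A₁ A₂ : Matrix n n ℂ) (t₀ t : ℝ) :
    path A₁ A₂ t = path A₁ A₂ t₀ + (t - t₀) • (A₁ - A₂) := by
  simp only [path]
  module

theorem mlog_transpose {A : Matrix n n ℂ} (hA : A.PosDef) : mlog Aᵀ = (mlog A)ᵀ := by
  nth_rw 1 [← exp_mlog hA]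
  rw [← Matrix.exp_transpose, mlog_exp (isHermitian_mlog A).transpose]

/-- The linear functional `M ↦ ⟨V_I, M V_I⟩` as a continuous linear map. -/
noncomputable def vecIForm (n : Type*) [Fintype n] [DecidableEq n] :
    Matrix (n × n) (n × n) ℂ →L[ℝ] ℂ :=
  LinearMap.toContinuousLinearMap
    { toFun := fun M => star (vecI n) ⬝ᵥ (M *ᵥ vecI n)
      map_add' := fun M N => by rw [Matrix.add_mulVec, dotProduct_add]
      map_smul' := fun r M => by rw [Matrix.smul_mulVec, dotProduct_smul]; rfl }

theorem vecIForm_apply (M : Matrix (n × n) (n × n) ℂ) :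
    vecIForm n M = star (vecI n) ⬝ᵥ (M *ᵥ vecI n) := rfl

theorem vecIForm_kronecker (A B : Matrix n n ℂ) : vecIForm n (A ⊗ₖ B) = (A * Bᵀ).trace := by
  simp [vecIForm_apply, dotProduct, Matrix.mulVec, vecI, Fintype.sum_prod_type, Matrix.trace,
    Matrix.mul_apply, apply_ite]

theorem vecIForm_Flog (A : Matrix n n ℂ) {B : Matrix n n ℂ} (hB : B.PosDef) :
    vecIForm n (Flog A Bᵀ) = relEntropy A B := by
  rw [Flog, map_sub, vecIForm_kronecker, vecIForm_kronecker, relEntropy, mlog2_eq Bᵀ,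
    mlog_transpose hB, ← Matrix.transpose_smul, ← mlog2_eq, Matrix.transpose_transpose,
    Matrix.transpose_one, mul_one]

/-- The interpolation formula behind the integral representation of the relative entropy. -/
theorem interpolation_of_second_deriv {h h₁ h₂ : ℝ → ℂ}
    (hd : ∀ s ∈ Icc (0 : ℝ) 1, HasDerivAt h (h₁ s) s)
    (hd₁ : ∀ s ∈ Icc (0 : ℝ) 1, HasDerivAt h₁ (h₂ s) s) (hc : ContinuousOn h₂ (Icc 0 1))
    {t : ℝ} (ht : t ∈ Icc (0 : ℝ) 1) :
    h t = t * h 1 + (1 - t) * h 0 - t * ∫ l in (0 : ℝ)..1, ∫ σ in (t * l)..l, h₂ σ := by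
  have hc₁ : ContinuousOn h₁ (Icc 0 1) := fun s hs => (hd₁ s hs).continuousAt.continuousWithinAt
  have hmem : ∀ l ∈ Icc (0 : ℝ) 1, t * l ∈ Icc (0 : ℝ) 1 := fun l hl =>
    ⟨mul_nonneg ht.1 hl.1, mul_le_one₀ ht.2 hl.1 hl.2⟩
  have e1 : ∀ l ∈ uIcc (0 : ℝ) 1, ∫ σ in (t * l)..l, h₂ σ = h₁ l - h₁ (t * l) := by
    intro l hl
    rw [uIcc_of_le zero_le_one] at hl
    have hsub : uIcc (t * l) l ⊆ Icc 0 1 := by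
      rw [← uIcc_of_le (zero_le_one' ℝ)] at hl ⊢
      exact uIcc_subset_uIcc (by
        rw [uIcc_of_le zero_le_one] at hl ⊢; exact hmem l hl) hl
    exact intervalIntegral.integral_eq_sub_of_hasDerivAt (fun s hs => hd₁ s (hsub hs))
      (hc.mono hsub).intervalIntegrable
  have hct : ContinuousOn (fun l => h₁ (t * l)) (Icc 0 1) :=
    hc₁.comp (by fun_prop) hmem
  have hi₁ : IntervalIntegrable h₁ volume 0 1 := by
    refine ContinuousOn.intervalIntegrable ?_
    rwa [uIcc_of_le zero_le_one]
  have hi₂ : IntervalIntegrable (fun l => h₁ (t * l)) volume 0 1 := by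
    refine ContinuousOn.intervalIntegrable ?_
    rwa [uIcc_of_le zero_le_one]
  have e2 : ∫ l in (0 : ℝ)..1, h₁ l = h 1 - h 0 :=
    intervalIntegral.integral_eq_sub_of_hasDerivAt (fun s hs => hd s (by
      rwa [uIcc_of_le zero_le_one] at hs)) hi₁
  have e3 : ∫ l in (0 : ℝ)..1, t * h₁ (t * l) = h t - h 0 := by
    have := intervalIntegral.integral_eq_sub_of_hasDerivAt (a := 0) (b := 1)
      (f := fun l => h (t * l)) (f' := fun l => (t : ℂ) * h₁ (t * l)) (fun s hs => by
        rw [uIcc_of_le zero_le_one] at hs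
        have := (hd _ (hmem s hs)).scomp s ((hasDerivAt_id s).const_mul t)
        simpa [Function.comp_def] using this) (hi₂.const_mul _)
    simpa using this
  -- Keeping the factor `t` inside the integral above avoids a case distinction at `t = 0`.
  rw [intervalIntegral.integral_const_mul] at e3
  rw [intervalIntegral.integral_congr e1, intervalIntegral.integral_sub hi₁ hi₂, e2, mul_sub, e3]
  ring

variable {A₁ A₂ B₁ B₂ : Matrix n n ℂ}

theorem Flog_path_eq (t₀ : ℝ) :
    (fun t : ℝ => Flog (path A₁ A₂ t) (path B₁ B₂ t)) = fun t =>
      flogLine (path A₁ A₂ t₀) (path B₁ B₂ t₀) (A₁ - A₂) (B₁ - B₂) (t - t₀) := by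
  ext1 t
  rw [flogLine, ← path_eq_line, ← path_eq_line]

variable (hA₁ : A₁.PosDef) (hA₂ : A₂.PosDef) (hB₁ : B₁.PosDef) (hB₂ : B₂.PosDef)
include hA₁ hA₂ hB₁ hB₂

theorem contDiffAt_Flog_path {t : ℝ} (ht : t ∈ Icc (0 : ℝ) 1) :
    ContDiffAt ℝ ω (fun t : ℝ => Flog (path A₁ A₂ t) (path B₁ B₂ t)) t := by
  rw [Flog_path_eq t]
  refine ContDiffAt.comp (g := flogLine (path A₁ A₂ t) (path B₁ B₂ t) (A₁ - A₂) (B₁ - B₂)) t ?_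
    (contDiffAt_id.sub contDiffAt_const)
  simp only [sub_self]
  exact contDiffAt_flogLine (posDef_path hA₁ hA₂ ht) (posDef_path hB₁ hB₂ ht)
    (hA₁.1.sub hA₂.1) (hB₁.1.sub hB₂.1)

omit hA₁ hA₂ hB₁ hB₂ in
theorem iteratedDeriv_two_Flog_path (t : ℝ) :
    iteratedDeriv 2 (fun t : ℝ => Flog (path A₁ A₂ t) (path B₁ B₂ t)) t
      = (2 * Real.logb 2 (Real.exp 1)) •
        gammaLim (path A₁ A₂ t) (path B₁ B₂ t) (A₁ - A₂) (B₁ - B₂) := by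
  have hlog : Real.log 2 ≠ 0 := (Real.log_pos (by norm_num)).ne'
  rw [Flog_path_eq t, iteratedDeriv_comp_sub_const]
  simp only [sub_self]
  rw [gammaLim, smul_smul, Real.logb, Real.log_exp]
  rw [show 2 * (1 / Real.log 2) * (Real.log 2 / 2) = 1 by field_simp, one_smul]

theorem relEntropy_path {t : ℝ} (ht : t ∈ Icc (0 : ℝ) 1) :
    relEntropy (path A₁ A₂ t) (path B₁ B₂ t)
      = t * relEntropy A₁ B₁ + (1 - t) * relEntropy A₂ B₂
        - 2 * Real.logb 2 (Real.exp 1) * t *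
          ∫ l in (0 : ℝ)..1, ∫ σ in (t * l)..l,
            star (vecI n) ⬝ᵥ (gammaLim (path A₁ A₂ σ) (path B₁ᵀ B₂ᵀ σ) (A₁ - A₂) (B₁ᵀ - B₂ᵀ)
              *ᵥ vecI n) := by
  set F : ℝ → Matrix (n × n) (n × n) ℂ := fun t => Flog (path A₁ A₂ t) (path B₁ᵀ B₂ᵀ t) with hF
  have hFc : ∀ s ∈ Icc (0 : ℝ) 1, ContDiffAt ℝ ω F s := fun s hs =>
    contDiffAt_Flog_path hA₁ hA₂ hB₁.transpose hB₂.transpose hs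
  set c : ℝ := 2 * Real.logb 2 (Real.exp 1) with hcdef
  have hd2 : ∀ s ∈ Icc (0 : ℝ) 1, HasDerivAt (fun s => vecIForm n (deriv F s))
      (vecIForm n (iteratedDeriv 2 F s)) s := fun s hs =>
    HasFDerivAt.comp_hasDerivAt s (vecIForm n).hasFDerivAt
      (hasDerivAt_deriv_of_contDiffAt (hFc s hs))
  have hcont : ContinuousOn (fun s => vecIForm n (iteratedDeriv 2 F s)) (Icc 0 1) := by
    intro s hs
    have h := contDiffAt_deriv (contDiffAt_deriv (hFc s hs))
    have h2 : iteratedDeriv 2 F = deriv (deriv F) := by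
      rw [iteratedDeriv_succ, iteratedDeriv_one]
    rw [h2]
    exact ((vecIForm n).continuous.continuousAt.comp h.continuousAt).continuousWithinAt
  have key := interpolation_of_second_deriv (h := fun s => vecIForm n (F s))
    (fun s hs => HasFDerivAt.comp_hasDerivAt s (vecIForm n).hasFDerivAt
      ((hFc s hs).differentiableAt (by simp)).hasDerivAt) hd2 hcont ht
  have hval : ∀ s ∈ Icc (0 : ℝ) 1,
      vecIForm n (F s) = relEntropy (path A₁ A₂ s) (path B₁ B₂ s) := by
    intro s hs
    have : path B₁ᵀ B₂ᵀ s = (path B₁ B₂ s)ᵀ := by simp [path]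
    rw [hF]
    simp only [this]
    exact vecIForm_Flog _ (posDef_path hB₁ hB₂ hs)
  have hint : ∀ s, vecIForm n (iteratedDeriv 2 F s) = (c : ℂ) * (star (vecI n) ⬝ᵥ
      (gammaLim (path A₁ A₂ s) (path B₁ᵀ B₂ᵀ s) (A₁ - A₂) (B₁ᵀ - B₂ᵀ) *ᵥ vecI n)) := by
    intro s
    rw [hF, iteratedDeriv_two_Flog_path, map_smul, vecIForm_apply, Complex.real_smul]
  simp only [hint, intervalIntegral.integral_const_mul] at key
  rw [hval t ht, hval 1 (by simp), hval 0 (by simp)] at key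
  rw [key]
  simp only [path, hcdef]
  push_cast
  simp only [one_smul, zero_smul, sub_self, add_zero, sub_zero, zero_add]
  ring

end Entropy

end JointConvexity

theorem mainTheorem5 {n : Type*} [Fintype n] [DecidableEq n] :
    ∃ (Γ : Matrix n n ℂ → Matrix n n ℂ → Matrix n n ℂ → Matrix n n ℂ → ℝ →
          Matrix (n × n) (n × n) ℂ)
      (C : Matrix n n ℂ → Matrix n n ℂ → Matrix n n ℂ → Matrix n n ℂ → ℝ),
      ∀ A₁ A₂ B₁ B₂ : Matrix n n ℂ, A₁.PosDef → A₂.PosDef → B₁.PosDef → B₂.PosDef →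
        (∀ t₀ ∈ Set.Icc (0 : ℝ) 1, ∀ Ψ Φ V W : Matrix n n ℂ,
          Ψ = JointConvexity.path A₁ A₂ t₀ → Φ = JointConvexity.path B₁ B₂ t₀ →
          V = A₁ - A₂ → W = B₁ - B₂ →
          (∀ k : ℕ, 1 ≤ k →
            ContDiffAt ℝ 2 (fun ε : ℝ => JointConvexity.Fk k (Ψ + ε • V) (Φ + ε • W)) 0 ∧
            iteratedDeriv 2 (fun ε : ℝ => JointConvexity.Fk k (Ψ + ε • V) (Φ + ε • W)) 0
              = (-2 : ℝ) • JointConvexity.GammaK Ψ Φ V W k ∧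
            (JointConvexity.GammaK Ψ Φ V W k).PosSemidef ∧
            ‖(2 ^ k : ℝ) • JointConvexity.GammaK Ψ Φ V W k - Γ A₁ A₂ B₁ B₂ t₀‖
              ≤ C Ψ Φ V W * (2 ^ k)⁻¹) ∧
          (Γ A₁ A₂ B₁ B₂ t₀).PosSemidef ∧
          ContDiffAt ℝ 2 (fun t : ℝ => JointConvexity.Flog
            (JointConvexity.path A₁ A₂ t) (JointConvexity.path B₁ B₂ t)) t₀ ∧
          iteratedDeriv 2 (fun t : ℝ => JointConvexity.Flog
            (JointConvexity.path A₁ A₂ t) (JointConvexity.path B₁ B₂ t)) t₀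
              = (2 * Real.logb 2 (Real.exp 1)) • Γ A₁ A₂ B₁ B₂ t₀) ∧
        (∀ t ∈ Set.Icc (0 : ℝ) 1,
          JointConvexity.relEntropy (JointConvexity.path A₁ A₂ t) (JointConvexity.path B₁ B₂ t)
            = t * JointConvexity.relEntropy A₁ B₁ + (1 - t) * JointConvexity.relEntropy A₂ B₂
              - 2 * Real.logb 2 (Real.exp 1) * t *
                ∫ l in (0 : ℝ)..1, ∫ σ in (t * l)..l,
                  star (JointConvexity.vecI n) ⬝ᵥ
                    (Γ A₁ A₂ B₁ᵀ B₂ᵀ σ *ᵥ JointConvexity.vecI n)) := by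
  refine ⟨fun A₁ A₂ B₁ B₂ t => JointConvexity.gammaLim (JointConvexity.path A₁ A₂ t)
    (JointConvexity.path B₁ B₂ t) (A₁ - A₂) (B₁ - B₂), JointConvexity.rateConst, ?_⟩
  intro A₁ A₂ B₁ B₂ hA₁ hA₂ hB₁ hB₂
  refine ⟨?_, fun t ht => JointConvexity.relEntropy_path hA₁ hA₂ hB₁ hB₂ ht⟩
  rintro t₀ ht₀ Ψ Φ V W rfl rfl rfl rfl
  have hΨ := JointConvexity.posDef_path hA₁ hA₂ ht₀
  have hΦ := JointConvexity.posDef_path hB₁ hB₂ ht₀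
  have hV := hA₁.1.sub hA₂.1
  have hW := hB₁.1.sub hB₂.1
  refine ⟨fun k _ => ⟨?_, ?_, JointConvexity.posSemidef_GammaK hΨ hΦ hV hW k,
    JointConvexity.rateConst_spec hΨ hΦ hV hW k⟩,
    JointConvexity.posSemidef_gammaLim hΨ hΦ hV hW,
    (JointConvexity.contDiffAt_Flog_path hA₁ hA₂ hB₁ hB₂ ht₀).of_le le_top,
    JointConvexity.iteratedDeriv_two_Flog_path t₀⟩
  · exact ((JointConvexity.contDiffAt_kronLine hΨ hΦ hV hW _ _).congr_of_eventuallyEq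
      (JointConvexity.eventually_Fk_line hΨ hΦ hV hW k)).of_le le_top
  · rw [(JointConvexity.eventually_Fk_line hΨ hΦ hV hW k).iteratedDeriv_eq,
      JointConvexity.iteratedDeriv_two_kronLine hΨ hΦ hV hW]
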